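/- **Conventions.** Manifolds are smooth, Hausdorff and without boundary, not necessarily connected. On $\mathbb R^7$ with coordinates $(x_1,\dots,x_7)$, write $\mathrm d\mathbf x_{ij\dots l}=\mathrm dx_i\wedge\mathrm dx_j\wedge\cdots\wedge\mathrm dx_l$ and put $$\varphi_0=\mathrm d\mathbf x_{123}+\mathrm d\mathbf x_{145}+\mathrm d\mathbf x_{167}+\mathrm d\mathbf x_{246}-\mathrm d\mathbf x_{257}-\mathrm d\mathbf x_{347}-\mathrm d\mathbf x_{356},$$ $$*\varphi_0=\mathrm d\mathbf x_{4567}+\mathrm d\mathbf x_{2367}+\mathrm d\mathbf x_{2345}+\mathrm d\mathbf x_{1357}-\mathrm d\mathbf x_{1346}-\mathrm d\mathbf x_{1256}-\mathrm d\mathbf x_{1247}.$$ Let $X$ be a 7-manifold. A smooth 3-form $\varphi$ (respectively 4-form $\psi$) on $X$ is *positive* if for each $x\in X$ there is an isomorphism $T_xX\cong\mathbb R^7$ identifying $\varphi|_x$ with $\varphi_0$ (respectively $\psi|_x$ with $*\varphi_0$). A positive 3-form induces an orientation of $X$, through such isomorphisms and the standard orientation of $\mathbb R^7$. If $X$ is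 oriented, a positive 4-form $\psi$ defines a $G_2$-structure $P_\psi$, consisting of the oriented isomorphisms $T_xX\cong\mathbb R^7$ identifying $\psi|_x$ with $*\varphi_0$. These isomorphisms carry $\varphi_0$ and the Euclidean metric to a 3-form and a metric on $T_xX$, and an oriented 3-plane $V\subset T_xX$ is *associative with respect to $P_\psi$* if this 3-form restricts on $V$ to the volume form of $V$ for this metric. $(X,\varphi,\psi)$ is a *tamed almost-$G_2$-manifold* (*TA-$G_2$-manifold*) if $\varphi$ is a closed positive 3-form on $X$, $\psi$ is a closed positive 4-form on $X$, and, using the orientation of $X$ induced by $\varphi$ to define $P_\psi$, we have $\varphi|_V>0$ for all $x\in X$ and all oriented 3-planes $V\subset T_xX$ which are associative with respect to $P_\psi$. Spaces of smooth forms have the $C^\infty$ topology, and spaces of closed forms the subspace topology. A *convex cone* in a real vector space is a (possibly empty) subset closed under sums and under multiplication by positive scalars. **Proposition 2.2.** **(a)** Let $X$ be a compact oriented 7-manifold and $\psi$ a closed positive 4-form on $X$. Then the set $\mathcal C_{X,\psi}$ of all $\varphi\in\Gamma^\infty(\Lambda^3T^*X)$ such that $(X,\varphi,\psi)$ is a TA-$G_2$-manifold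 and $\varphi$ induces the given orientation of $X$ is an open convex cone in $\{\varphi\in\Gamma^\infty(\Lambda^3T^*X):\mathrm d\varphi=0\}$. Hence $\mathcal K_{X,\psi}:=\{[\varphi]:\varphi\in\mathcal C_{X,\psi}\}$ is an open convex cone in $H^3_{\rm dR}(X;\mathbb R)$. **(b)** Let $X$ be a compact 7-manifold and $\varphi$ a closed positive 3-form on $X$. Then the set $\mathcal C'_{X,\varphi}$ of all $\psi\in\Gamma^\infty(\Lambda^4T^*X)$ such that $(X,\varphi,\psi)$ is a TA-$G_2$-manifold is an open convex cone in $\{\psi\in\Gamma^\infty(\Lambda^4T^*X):\mathrm d\psi=0\}$. Hence $\mathcal K'_{X,\varphi}:=\{[\psi]:\psi\in\mathcal C'_{X,\varphi}\}$ is an open convex cone in $H^4_{\rm dR}(X;\mathbb R)$. Here open in $H^k_{\rm dR}(X;\mathbb R)$ means open both in the quotient of the $C^\infty$ topology on closed $k$-forms and in the canonical topology of a finite-dimensional real vector space. -/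

import Mathlib

open scoped Manifold ContDiff Topology

noncomputable section

namespace TAG2

/-! ### The linear model: `ℝ⁷` with its standard 3-form and 4-form -/

/-- Euclidean `ℝ⁷`; the coordinates `x₁, …, x₇` are indexed by `0, …, 6`. -/
abbrev E7 : Type := EuclideanSpace ℝ (Fin 7)

/-- The constant form `dx_{s 0} ∧ ⋯ ∧ dx_{s (k-1)}` on `ℝ⁷`:
its value at `(v_0, …, v_{k-1})` is the determinant of the matrix `(dx_{s a} (v_b))`. -/
def dx {k : ℕ} (s : Fin k → Fin 7) : E7 [⋀^Fin k]→L[ℝ] ℝ :=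
  { (Matrix.detRowAlternating (R := ℝ) (n := Fin k)).compLinearMap
      (LinearMap.pi fun a : Fin k =>
        ((EuclideanSpace.proj (s a) : E7 →L[ℝ] ℝ) : E7 →ₗ[ℝ] ℝ)) with
    cont := by
      change Continuous fun v : Fin k → E7 =>
        Matrix.det (fun b a : Fin k => (v b) (s a))
      apply Continuous.matrix_det
      fun_prop }

theorem dx_apply {k : ℕ} (s : Fin k → Fin 7) (v : Fin k → E7) :
    dx s v = Matrix.det (Matrix.of fun b a : Fin k => (v b) (s a)) := rfl

/-- The standard `G₂` 3-form
`dx₁₂₃ + dx₁₄₅ + dx₁₆₇ + dx₂₄₆ - dx₂₅₇ - dx₃₄₇ - dx₃₅₆`. -/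
def phi0 : E7 [⋀^Fin 3]→L[ℝ] ℝ :=
  dx ![0, 1, 2] + dx ![0, 3, 4] + dx ![0, 5, 6] + dx ![1, 3, 5]
    - dx ![1, 4, 6] - dx ![2, 3, 6] - dx ![2, 4, 5]

/-- The Hodge dual of `phi0`:
`dx₄₅₆₇ + dx₂₃₆₇ + dx₂₃₄₅ + dx₁₃₅₇ - dx₁₃₄₆ - dx₁₂₅₆ - dx₁₂₄₇`. -/
def starPhi0 : E7 [⋀^Fin 4]→L[ℝ] ℝ :=
  dx ![3, 4, 5, 6] + dx ![1, 2, 5, 6] + dx ![1, 2, 3, 4] + dx ![0, 2, 4, 6]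
    - dx ![0, 2, 3, 5] - dx ![0, 1, 4, 5] - dx ![0, 1, 3, 6]

/-- The standard orientation of `ℝ⁷`. -/
def stdOrientation : Orientation ℝ E7 (Fin 7) :=
  (EuclideanSpace.basisFun (Fin 7) ℝ).toBasis.orientation

section Linear

variable {V : Type*} [AddCommGroup V] [Module ℝ V] [TopologicalSpace V]

/-- `V ≅ ℝ⁷` carries the orientation `o` of `V` to the standard one. -/
def IsOriented (o : Orientation ℝ V (Fin 7)) (L : V ≃L[ℝ] E7) : Prop :=
  Orientation.map (Fin 7) L.toLinearEquiv o = stdOrientation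

/-- The isomorphisms `V ≅ ℝ⁷` identifying the 3-form `α` with `phi0`
(the fibre of the `G₂`-structure `P_φ`, when `α` is the value of `φ`). -/
def frames3 (α : V [⋀^Fin 3]→L[ℝ] ℝ) : Set (V ≃L[ℝ] E7) :=
  {L | phi0.compContinuousLinearMap (L : V →L[ℝ] E7) = α}

/-- The isomorphisms `V ≅ ℝ⁷` identifying the 4-form `β` with `starPhi0`. -/
def frames4 (β : V [⋀^Fin 4]→L[ℝ] ℝ) : Set (V ≃L[ℝ] E7) :=
  {L | starPhi0.compContinuousLinearMap (L : V →L[ℝ] E7) = β}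

/-- The oriented isomorphisms `V ≅ ℝ⁷` identifying the 4-form `β` with `starPhi0`
(the fibre of the `G₂`-structure `P_ψ`, when `β` is the value of `ψ`). -/
def orientedFrames4 (o : Orientation ℝ V (Fin 7)) (β : V [⋀^Fin 4]→L[ℝ] ℝ) :
    Set (V ≃L[ℝ] E7) :=
  {L | IsOriented o L ∧ L ∈ frames4 β}

/-- Let `P` be a `G₂`-structure on the vector space `V`, given by its set of adapted isomorphisms
`L : V ≅ ℝ⁷`, with 3-form `L^* phi0` and inner product `L^* g₀`.
The oriented 3-plane in `V` with oriented basis `v` is *associative* for `P` if it is calibrated by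
the 3-form: the 3-form of `P` takes on `v` the same value as the Riemannian volume form of the
3-plane, which is `√(det (⟨v_i, v_j⟩))`. -/
def IsAssociative (P : Set (V ≃L[ℝ] E7)) (v : Fin 3 → V) : Prop :=
  LinearIndependent ℝ v ∧
    ∃ L ∈ P, phi0 (fun i => L (v i)) = √(Matrix.gram ℝ (fun i => L (v i))).det

end Linear

/-! ### Differential forms and de Rham cohomology of a 7-manifold -/

section Forms

variable (X : Type*) [TopologicalSpace X] [ChartedSpace E7 X]

/-- Not necessarily continuous sections of `Λᵏ T^*X`. -/
abbrev RoughForm (k : ℕ) : Type _ :=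
  ∀ x : X, (TangentSpace (𝓡 7) x) [⋀^Fin k]→L[ℝ] ℝ

variable {X}

/-- The pullback of `θ` to `ℝ⁷` by the inverse of the preferred chart at `x₀`
(meaningful on the target of this chart). -/
def chartRep {k : ℕ} (θ : RoughForm X k) (x₀ : X) (y : E7) : E7 [⋀^Fin k]→L[ℝ] ℝ :=
  (θ ((chartAt E7 x₀).symm y)).compContinuousLinearMap
    (mfderiv (𝓡 7) (𝓡 7) ((chartAt E7 x₀).symm : E7 → X) y)

theorem chartRep_add {k : ℕ} (θ η : RoughForm X k) (x₀ : X) :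
    chartRep (θ + η) x₀ = chartRep θ x₀ + chartRep η x₀ := rfl

theorem chartRep_smul {k : ℕ} (c : ℝ) (θ : RoughForm X k) (x₀ : X) :
    chartRep (c • θ) x₀ = c • chartRep θ x₀ := rfl

theorem chartRep_zero {k : ℕ} (x₀ : X) :
    chartRep (0 : RoughForm X k) x₀ = 0 := rfl

variable (X)

/-- Smooth `k`-forms: those that are smooth in each chart. -/
def smoothForms (k : ℕ) : Submodule ℝ (RoughForm X k) where
  carrier := {θ | ∀ x₀ : X, ContDiffOn ℝ ∞ (chartRep θ x₀) (chartAt E7 x₀).target}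
  zero_mem' := fun _ => contDiffOn_const (c := 0)
  add_mem' := fun hθ hη x₀ => (hθ x₀).add (hη x₀)
  smul_mem' := fun c _ hθ x₀ => (hθ x₀).const_smul c

/-- The vector space `Γ^∞(Λᵏ T^*X)` of smooth `k`-forms on `X`. -/
def DiffForm (k : ℕ) : Type _ := smoothForms X k

instance (k : ℕ) : AddCommGroup (DiffForm X k) := inferInstanceAs (AddCommGroup (smoothForms X k))

instance (k : ℕ) : Module ℝ (DiffForm X k) := inferInstanceAs (Module ℝ (smoothForms X k))

variable {X}

/-- The value of a smooth form at a point. -/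
def DiffForm.valAt {k : ℕ} (θ : DiffForm X k) (x : X) :
    (TangentSpace (𝓡 7) x) [⋀^Fin k]→L[ℝ] ℝ := θ.1 x

/-- The representative of a smooth form in the preferred chart at `x₀`. -/
def DiffForm.rep {k : ℕ} (θ : DiffForm X k) (x₀ : X) : E7 → E7 [⋀^Fin k]→L[ℝ] ℝ :=
  chartRep θ.1 x₀

theorem DiffForm.rep_add {k : ℕ} (θ η : DiffForm X k) (x₀ : X) :
    (θ + η).rep x₀ = θ.rep x₀ + η.rep x₀ := rfl

theorem DiffForm.rep_smul {k : ℕ} (c : ℝ) (θ : DiffForm X k) (x₀ : X) :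
    (c • θ).rep x₀ = c • θ.rep x₀ := rfl

theorem DiffForm.rep_zero {k : ℕ} (x₀ : X) : (0 : DiffForm X k).rep x₀ = 0 := rfl

theorem DiffForm.differentiableAt_rep {k : ℕ} (θ : DiffForm X k) (x₀ : X) {y : E7}
    (hy : y ∈ (chartAt E7 x₀).target) : DifferentiableAt ℝ (θ.rep x₀) y :=
  ((θ.2 x₀).contDiffAt ((chartAt E7 x₀).open_target.mem_nhds hy)).differentiableAt (by simp)

/-- The `C^∞` topology on smooth `k`-forms: uniform convergence on compact subsets of the chart
targets of the coordinate representatives and of all their iterated derivatives. -/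
instance (k : ℕ) : TopologicalSpace (DiffForm X k) :=
  ⨅ (x₀ : X) (j : ℕ), TopologicalSpace.induced
    (fun θ : DiffForm X k =>
      UniformOnFun.ofFun {K : Set (chartAt E7 x₀).target | IsCompact K}
        (fun y => iteratedFDeriv ℝ j (θ.rep x₀) y))
    inferInstance

/-- `dη = θ`, checked in the charts. -/
def IsExtDeriv {k : ℕ} (η : DiffForm X k) (θ : DiffForm X (k + 1)) : Prop :=
  ∀ x₀ : X, ∀ y ∈ (chartAt E7 x₀).target, extDeriv (η.rep x₀) y = θ.rep x₀ y

variable (X)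

/-- The closed `k`-forms, with the topology induced by the `C^∞` topology. -/
def closedForms (k : ℕ) : Submodule ℝ (DiffForm X k) where
  carrier := {θ | ∀ x₀ : X, ∀ y ∈ (chartAt E7 x₀).target, extDeriv (θ.rep x₀) y = 0}
  zero_mem' := by
    intro x₀ y hy
    have h := extDeriv_smul (0 : ℝ) (fun _ : E7 => (0 : E7 [⋀^Fin k]→L[ℝ] ℝ)) (x := y)
    rw [zero_smul, zero_smul] at h
    exact h
  add_mem' := by
    intro θ η hθ hη x₀ y hy
    rw [DiffForm.rep_add, extDeriv_add (θ.differentiableAt_rep x₀ hy)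
      (η.differentiableAt_rep x₀ hy), hθ x₀ y hy, hη x₀ y hy, add_zero]
  smul_mem' := by
    intro c θ hθ x₀ y hy
    rw [DiffForm.rep_smul, extDeriv_smul, hθ x₀ y hy, smul_zero]

/-- The exact `k`-forms. -/
def exactForms : (k : ℕ) → Submodule ℝ (DiffForm X k)
  | 0 => ⊥
  | k + 1 =>
    { carrier := {θ | ∃ η : DiffForm X k, IsExtDeriv η θ}
      zero_mem' := by
        refine ⟨0, fun x₀ y hy => ?_⟩
        have h := (closedForms X k).zero_mem x₀ y hy
        rw [h, DiffForm.rep_zero]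
        rfl
      add_mem' := by
        rintro θ₁ θ₂ ⟨η₁, h₁⟩ ⟨η₂, h₂⟩
        refine ⟨η₁ + η₂, fun x₀ y hy => ?_⟩
        rw [DiffForm.rep_add, extDeriv_add (η₁.differentiableAt_rep x₀ hy)
          (η₂.differentiableAt_rep x₀ hy), h₁ x₀ y hy, h₂ x₀ y hy, DiffForm.rep_add]
        rfl
      smul_mem' := by
        rintro c θ ⟨η, h⟩
        refine ⟨c • η, fun x₀ y hy => ?_⟩
        rw [DiffForm.rep_smul, extDeriv_smul, h x₀ y hy, DiffForm.rep_smul]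
        rfl }

/-- Exact forms are closed (`d ∘ d = 0`). -/
theorem exactForms_le_closedForms (k : ℕ) : exactForms X k ≤ closedForms X k := by
  cases k with
  | zero => exact bot_le
  | succ k =>
    rintro θ ⟨η, h⟩ x₀ y hy
    have hev : θ.rep x₀ =ᶠ[𝓝 y] extDeriv (η.rep x₀) := by
      filter_upwards [(chartAt E7 x₀).open_target.mem_nhds hy] with z hz
      exact (h x₀ z hz).symm
    rw [hev.extDeriv_eq]
    have hs : ContDiffAt ℝ ∞ (η.rep x₀) y :=
      (η.2 x₀).contDiffAt ((chartAt E7 x₀).open_target.mem_nhds hy)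
    exact extDeriv_extDeriv_apply hs (by
      simp only [minSmoothness_of_isRCLikeNormedField]
      exact WithTop.coe_le_coe.2 le_top)

/-- The de Rham cohomology `H^k_dR(X; ℝ)`, closed forms modulo exact forms, with the quotient of
the `C^∞` topology. -/
abbrev HdR (k : ℕ) : Type _ :=
  closedForms X k ⧸ (exactForms X k).submoduleOf (closedForms X k)

variable {X}

/-- The de Rham class of a closed form. -/
def deRhamClass {k : ℕ} (θ : closedForms X k) : HdR X k :=
  Submodule.Quotient.mk θ

end Forms

/-! ### Orientations and tamed almost-`G₂`-manifolds -/

section Manifold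

/-- The orientation of `ℝ⁷` that corresponds to an orientation of `T_xX` under the derivative at `x`
of the preferred chart at `x₀`. -/
def orientInChart {X : Type*} [TopologicalSpace X] [ChartedSpace E7 X] [IsManifold (𝓡 7) ∞ X]
    (x₀ : X) (x : (chartAt E7 x₀).source)
    (o : Orientation ℝ (TangentSpace (𝓡 7) (x : X)) (Fin 7)) : Orientation ℝ E7 (Fin 7) :=
  Orientation.map (Fin 7) ((mdifferentiable_chart (I := 𝓡 7) x₀).mfderiv x.2).toLinearEquiv o

/-- An orientation of a 7-manifold: an orientation of each tangent space, locally constant when read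
in any chart. -/
structure ManifoldOrientation (X : Type*) [TopologicalSpace X] [ChartedSpace E7 X]
    [IsManifold (𝓡 7) ∞ X] where
  /-- the orientation of the tangent space at `x` -/
  orientAt : ∀ x : X, Orientation ℝ (TangentSpace (𝓡 7) x) (Fin 7)
  locallyConstant : ∀ x₀ : X,
    IsLocallyConstant fun x : (chartAt E7 x₀).source => orientInChart x₀ x (orientAt x)

variable {X : Type*} [TopologicalSpace X] [ChartedSpace E7 X]

/-- A 3-form is positive if at each point some isomorphism `T_xX ≅ ℝ⁷` identifies it
with `phi0`. -/
def IsPositive3 (φ : DiffForm X 3) : Prop := ∀ x : X, (frames3 (φ.valAt x)).Nonempty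

/-- A 4-form is positive if at each point some isomorphism `T_xX ≅ ℝ⁷` identifies it
with `starPhi0`. -/
def IsPositive4 (ψ : DiffForm X 4) : Prop := ∀ x : X, (frames4 (ψ.valAt x)).Nonempty

variable [IsManifold (𝓡 7) ∞ X]

/-- The orientation `o` is the one induced by the `G₂`-structure of the positive 3-form `φ`. -/
def IsInducedBy (o : ManifoldOrientation X) (φ : DiffForm X 3) : Prop :=
  ∀ x : X, ∀ L ∈ frames3 (φ.valAt x), IsOriented (o.orientAt x) L

/-- `(X, φ, ψ)` is a tamed almost-`G₂`-manifold, and `o` is the orientation that `φ` induces. -/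
structure IsOrientedTAG2 (o : ManifoldOrientation X) (φ : DiffForm X 3) (ψ : DiffForm X 4) :
    Prop where
  closed_phi : φ ∈ closedForms X 3
  positive_phi : IsPositive3 φ
  closed_psi : ψ ∈ closedForms X 4
  positive_psi : IsPositive4 ψ
  induced : IsInducedBy o φ
  /-- `φ|_V > 0` for every oriented 3-plane `V ⊆ T_xX` (with oriented basis `v`) that is associative
  for the `G₂`-structure of `ψ` and `o`. -/
  tamed : ∀ x : X, ∀ v : Fin 3 → TangentSpace (𝓡 7) x,
    IsAssociative (orientedFrames4 (o.orientAt x) (ψ.valAt x)) v → 0 < φ.valAt x v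

/-- `(X, φ, ψ)` is a tamed almost-`G₂`-manifold (for the orientation of `X` induced by `φ`). -/
def IsTAG2 (φ : DiffForm X 3) (ψ : DiffForm X 4) : Prop :=
  ∃ o : ManifoldOrientation X, IsOrientedTAG2 o φ ψ

/-- `𝒞_{X,ψ}` for an oriented manifold `X`: the closed 3-forms `φ`, inducing the given orientation,
such that `(X, φ, ψ)` is a tamed almost-`G₂`-manifold. -/
def coneC (o : ManifoldOrientation X) (ψ : DiffForm X 4) : Set (closedForms X 3) :=
  {φ | IsOrientedTAG2 o φ ψ}

/-- `𝒞'_{X,φ}`: the closed 4-forms `ψ` such that `(X, φ, ψ)` is a tamed almost-`G₂`-manifold. -/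
def coneC' (φ : DiffForm X 3) : Set (closedForms X 4) :=
  {ψ | IsTAG2 φ ψ}

end Manifold

/-- `S` is a convex cone: closed under sums and under multiplication by positive scalars. -/
def IsConvexCone {M : Type*} [AddCommGroup M] [Module ℝ M] (S : Set M) : Prop :=
  ∃ C : ConvexCone ℝ M, (C : Set M) = S

end TAG2

end

/-!
# Cones of tamed almost-`G₂`-structures

Everything rests on linear algebra in one tangent space. Call a 3-form on `ℝ⁷` *tame* if it is
positive on all associative 3-planes of the standard `G₂`-structure (`tameForms`). These forms make
up an open convex cone. The first fact that is not formal is that every tame form is positive in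
the sense of `G₂`-geometry and induces the standard orientation (`tameForms_subset_posOrbit`): the
tame forms are connected, the orbit of `phi0` is open (`image_phi0_comp_mem_nhds`), and it is closed
among the tame forms. The latter is a compactness argument. The determinant of
`φ (u, ·, ·) + ⟪u, ·⟫ ⟪u, ·⟫` does not vanish when `φ` is tame, and for `φ = L^* phi0` its square is
`det(L)⁴ |L u|⁸ |u|⁸`, which bounds `L`. The same determinant shows that the stabilizer of `phi0`
consists of isometries.

Hence, in a frame that is adapted to `ψ`, a pair `(φ, ψ)` is tamed iff `φ` is a tame form
(`isTamedPair_iff_of_mem_orientedFrames4`). This settles the convexity for fixed `ψ`. For fixed `φ`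
the roles have to be exchanged. In a frame adapted to `φ`, write `*ψ = M^* phi0`. Up to a positive
factor, the transpose of `M` passes from this frame to one adapted to `ψ`. So everything follows if
`M^* phi0` is tame exactly when `(Mᵀ)^* phi0` is (`phi0_comp_adjoint_mem_tameForms`). Tameness of
`M^* phi0` amounts, up to sign, to `M` mapping no associative 3-plane into a coassociative 4-plane.
As orthogonal complements exchange the two kinds of planes, this condition is invariant under
transposition; the sign is fixed by the determinant. Thus `(φ, ψ)` is tamed iff `*ψ` is tame in a
frame adapted to `φ` (`isTamedPair_iff_of_mem_frames3`), and this is convex in `ψ`.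

Since tamedness is also open in both forms together (`isOpen_isTamedPair`), compactness of the
manifold makes it open in the `C⁰` topology on forms, hence in the `C^∞` topology
(`eventually_isTamedPair`). The statements on cohomology follow because the projection to a quotient
of topological vector spaces is linear and open, and because the module topology on the quotient is
finer than the quotient topology.
-/

noncomputable section

namespace TAG2

open scoped RealInnerProductSpace

/-- Pullback of an alternating form along a linear map. -/
local infixl:70 " ⊙ " => ContinuousAlternatingMap.compContinuousLinearMap

/-! ### The cross product of `ℝ⁷` -/

/-- The cross product of `ℝ⁷` defined by `phi0` and the Euclidean metric:
`⟪u × v, w⟫ = phi0 (u, v, w)`. -/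
def cross (u v : E7) : E7 :=
  !₂[(u 1 * v 2 - u 2 * v 1) + (u 3 * v 4 - u 4 * v 3) + (u 5 * v 6 - u 6 * v 5),
    (u 2 * v 0 - u 0 * v 2) + (u 3 * v 5 - u 5 * v 3) - (u 4 * v 6 - u 6 * v 4),
    (u 0 * v 1 - u 1 * v 0) - (u 3 * v 6 - u 6 * v 3) - (u 4 * v 5 - u 5 * v 4),
    (u 4 * v 0 - u 0 * v 4) + (u 5 * v 1 - u 1 * v 5) - (u 6 * v 2 - u 2 * v 6),
    (u 0 * v 3 - u 3 * v 0) - (u 6 * v 1 - u 1 * v 6) - (u 5 * v 2 - u 2 * v 5),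
    (u 6 * v 0 - u 0 * v 6) + (u 1 * v 3 - u 3 * v 1) - (u 2 * v 4 - u 4 * v 2),
    (u 0 * v 5 - u 5 * v 0) - (u 1 * v 4 - u 4 * v 1) - (u 2 * v 3 - u 3 * v 2)]

theorem inner_eq_sum (u v : E7) : ⟪u, v⟫ =
    u 0 * v 0 + u 1 * v 1 + u 2 * v 2 + u 3 * v 3 + u 4 * v 4 + u 5 * v 5 + u 6 * v 6 := by
  simp only [PiLp.inner_apply, Fin.sum_univ_seven, RCLike.inner_apply, conj_trivial]
  ring

theorem phi0_apply (v : Fin 3 → E7) : phi0 v = ⟪cross (v 0) (v 1), v 2⟫ := by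
  simp only [phi0, ContinuousAlternatingMap.add_apply, ContinuousAlternatingMap.sub_apply,
    dx_apply, Matrix.det_fin_three, Matrix.of_apply, inner_eq_sum]
  simp [cross]
  ring

theorem cross_add_right (u v w : E7) : cross u (v + w) = cross u v + cross u w := by
  ext i; fin_cases i <;> simp [cross] <;> ring

theorem cross_smul_right (c : ℝ) (u v : E7) : cross u (c • v) = c • cross u v := by
  ext i; fin_cases i <;> simp [cross] <;> ring

theorem cross_swap (u v : E7) : cross u v = -cross v u := by
  ext i; fin_cases i <;> simp [cross] <;> ring

theorem cross_smul_left (c : ℝ) (u v : E7) : cross (c • u) v = c • cross u v := by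
  rw [cross_swap, cross_smul_right, cross_swap u, smul_neg]

theorem cross_self (u : E7) : cross u u = 0 := by
  ext i; fin_cases i <;> simp [cross] <;> ring

theorem inner_cross_rotate (u v w : E7) : ⟪cross u v, w⟫ = ⟪cross v w, u⟫ := by
  simp only [inner_eq_sum]; simp [cross]; ring

theorem inner_cross_left (u v : E7) : ⟪cross u v, u⟫ = 0 := by
  rw [inner_cross_rotate, inner_cross_rotate, cross_self, inner_zero_left]

theorem inner_cross_right (u v : E7) : ⟪cross u v, v⟫ = 0 := by
  rw [inner_cross_rotate, cross_self, inner_zero_left]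

/-- The identity on which the linear algebra of `G₂` rests. -/
theorem cross_cross_self (u v : E7) : cross u (cross u v) = ⟪u, v⟫ • u - ⟪u, u⟫ • v := by
  simp only [inner_eq_sum]
  ext i; fin_cases i <;> simp [cross] <;> ring

/-- The linearization of `cross_cross_self` in its first factor. -/
theorem cross_assoc (a b c : E7) : cross (cross a b) c + cross a (cross b c) =
    (2 * ⟪a, c⟫) • b - ⟪b, c⟫ • a - ⟪a, b⟫ • c := by
  simp only [inner_eq_sum]
  ext i; fin_cases i <;> simp [cross] <;> ring

/-- The cross product is as long as the area of the parallelogram. -/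
theorem inner_cross_cross (u v : E7) :
    ⟪cross u v, cross u v⟫ = ⟪u, u⟫ * ⟪v, v⟫ - ⟪u, v⟫ ^ 2 := by
  rw [inner_cross_rotate, inner_cross_rotate, cross_swap, cross_cross_self, neg_sub,
    inner_sub_left, inner_smul_left, inner_smul_left, conj_trivial, conj_trivial]
  ring

theorem det_fin_four (A : Matrix (Fin 4) (Fin 4) ℝ) : A.det =
    A 0 0 * (A 1 1 * (A 2 2 * A 3 3 - A 2 3 * A 3 2) - A 1 2 * (A 2 1 * A 3 3 - A 2 3 * A 3 1)
      + A 1 3 * (A 2 1 * A 3 2 - A 2 2 * A 3 1))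
    - A 0 1 * (A 1 0 * (A 2 2 * A 3 3 - A 2 3 * A 3 2) - A 1 2 * (A 2 0 * A 3 3 - A 2 3 * A 3 0)
      + A 1 3 * (A 2 0 * A 3 2 - A 2 2 * A 3 0))
    + A 0 2 * (A 1 0 * (A 2 1 * A 3 3 - A 2 3 * A 3 1) - A 1 1 * (A 2 0 * A 3 3 - A 2 3 * A 3 0)
      + A 1 3 * (A 2 0 * A 3 1 - A 2 1 * A 3 0))
    - A 0 3 * (A 1 0 * (A 2 1 * A 3 2 - A 2 2 * A 3 1) - A 1 1 * (A 2 0 * A 3 2 - A 2 2 * A 3 0)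
      + A 1 2 * (A 2 0 * A 3 1 - A 2 1 * A 3 0)) := by
  rw [Matrix.det_succ_row_zero]
  simp only [Fin.sum_univ_four, Matrix.det_fin_three, Matrix.submatrix_apply]
  simp [Fin.succAbove, Fin.lt_def]
  ring

/-- `starPhi0` in terms of `phi0` and the metric. -/
theorem starPhi0_apply (v : Fin 4 → E7) : starPhi0 v =
    ⟪cross (v 0) (v 1), cross (v 2) (v 3)⟫ - ⟪v 0, v 2⟫ * ⟪v 1, v 3⟫ + ⟪v 0, v 3⟫ * ⟪v 1, v 2⟫ := by
  simp only [starPhi0, ContinuousAlternatingMap.add_apply, ContinuousAlternatingMap.sub_apply,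
    dx_apply, det_fin_four, Matrix.of_apply, inner_eq_sum]
  simp [cross]
  ring

/-! ### The Hodge star from 4-forms to 3-forms -/

/-- The standard basis of `ℝ⁷`. -/
abbrev stdB : OrthonormalBasis (Fin 7) ℝ E7 := EuclideanSpace.basisFun (Fin 7) ℝ

/-- The standard volume form, with its seven arguments split as three and four. -/
def vol : E7 [⋀^Fin 3 ⊕ Fin 4]→ₗ[ℝ] ℝ :=
  (stdB.toBasis.reindex (finSumFinEquiv (m := 3) (n := 4)).symm).det

theorem vol_comp (L : E7 →L[ℝ] E7) (x : Fin 3 ⊕ Fin 4 → E7) :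
    vol (fun i => L (x i)) = L.det * vol x :=
  Module.Basis.det_comp _ (L : E7 →ₗ[ℝ] E7) x

/-- The volume form as a 3-form, with its last four arguments fixed. -/
def volLeft (w : Fin 4 → E7) : E7 [⋀^Fin 3]→L[ℝ] ℝ where
  toFun v := vol (Sum.elim v w)
  map_update_add' v i x y := by
    simp only [← Sum.update_elim_inl, AlternatingMap.map_update_add]
  map_update_smul' v i c x := by
    simp only [← Sum.update_elim_inl, AlternatingMap.map_update_smul]
  map_eq_zero_of_eq' v i j h hij :=
    vol.map_eq_zero_of_eq (i := Sum.inl i) (j := Sum.inl j) _ h (by simpa using hij)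
  cont := by
    simp only [vol, Module.Basis.det_apply]
    refine Continuous.matrix_det (continuous_matrix fun i j => ?_)
    simp only [Module.Basis.toMatrix_apply]
    cases j <;> simp <;> fun_prop

/-- The volume form as a 4-form, with its first three arguments fixed. -/
def volRight (v : Fin 3 → E7) : E7 [⋀^Fin 4]→ₗ[ℝ] ℝ where
  toFun w := vol (Sum.elim v w)
  map_update_add' w i x y := by
    simp only [← Sum.update_elim_inr, AlternatingMap.map_update_add]
  map_update_smul' w i c x := by
    simp only [← Sum.update_elim_inr, AlternatingMap.map_update_smul]
  map_eq_zero_of_eq' w i j h hij :=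
    vol.map_eq_zero_of_eq (i := Sum.inr i) (j := Sum.inr j) _ h (by simpa using hij)

/-- The Hodge star on 4-forms. The sum over all index functions counts each set of four indices
`4! = 24` times. -/
def star : (E7 [⋀^Fin 4]→L[ℝ] ℝ) →ₗ[ℝ] (E7 [⋀^Fin 3]→L[ℝ] ℝ) where
  toFun ψ := ∑ r : Fin 4 → Fin 7, (ψ (fun i => stdB (r i)) / 24) • volLeft fun i => stdB (r i)
  map_add' ψ χ := by
    simp only [ContinuousAlternatingMap.add_apply, add_div, add_smul, Finset.sum_add_distrib]
  map_smul' c ψ := by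
    simp only [ContinuousAlternatingMap.smul_apply, smul_eq_mul, mul_div_assoc, mul_smul,
      Finset.smul_sum, RingHom.id_apply]

theorem star_apply (ψ : E7 [⋀^Fin 4]→L[ℝ] ℝ) (v : Fin 3 → E7) : star ψ v =
    (∑ r : Fin 4 → Fin 7, ψ (fun i => stdB (r i)) * volRight v (fun i => stdB (r i))) / 24 := by
  have : star ψ v =
      ∑ r : Fin 4 → Fin 7, (ψ (fun i => stdB (r i)) / 24) * volRight v (fun i => stdB (r i)) :=
    ContinuousAlternatingMap.sum_apply _ _
  rw [this, Finset.sum_div]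
  exact Finset.sum_congr rfl fun r _ => by ring

/-- Contraction of two multilinear forms over the standard basis: a linear map moves from one
factor to the other as its adjoint. -/
theorem sum_apply_comp_mul {n : ℕ} (f g : MultilinearMap ℝ (fun _ : Fin n => E7) ℝ)
    (L : E7 →L[ℝ] E7) :
    ∑ r : Fin n → Fin 7, f (fun i => L (stdB (r i))) * g (fun i => stdB (r i)) =
      ∑ r : Fin n → Fin 7, f (fun i => stdB (r i)) *
        g (fun i => ContinuousLinearMap.adjoint L (stdB (r i))) := by
  have expand : ∀ (h : MultilinearMap ℝ (fun _ : Fin n => E7) ℝ) (x : Fin n → E7),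
      h x = ∑ t : Fin n → Fin 7, (∏ i, ⟪stdB (t i), x i⟫) * h (fun i => stdB (t i)) := by
    intro h x
    conv_lhs => rw [show x = fun i => ∑ j, ⟪stdB j, x i⟫ • stdB j from
      funext fun i => (stdB.sum_repr' (x i)).symm]
    rw [h.map_sum]
    exact Finset.sum_congr rfl fun t _ => h.map_smul_univ _ _
  simp_rw [expand f (fun i => L _), expand g (fun i => (ContinuousLinearMap.adjoint L) _),
    Finset.sum_mul, Finset.mul_sum]
  rw [Finset.sum_comm]
  refine Finset.sum_congr rfl fun t _ => Finset.sum_congr rfl fun r _ => ?_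
  simp only [ContinuousLinearMap.adjoint_inner_right]
  simp only [real_inner_comm]
  ring

theorem det_adjoint (L : E7 →L[ℝ] E7) : (ContinuousLinearMap.adjoint L).det = L.det := by
  have h := LinearMap.toMatrix_adjoint stdB stdB (L : E7 →ₗ[ℝ] E7)
  rw [ContinuousLinearMap.det, ContinuousLinearMap.det, ← LinearMap.det_toMatrix stdB.toBasis,
    ← LinearMap.det_toMatrix stdB.toBasis, ← ContinuousLinearMap.adjoint_toLinearMap, h,
    Matrix.det_conjTranspose, star_trivial]

/-- Equivariance of the Hodge star. The determinant shows that `star` sees orientation and scale. -/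
theorem star_comp (ψ : E7 [⋀^Fin 4]→L[ℝ] ℝ) (L : E7 →L[ℝ] E7) :
    (star (ψ.compContinuousLinearMap L)).compContinuousLinearMap (ContinuousLinearMap.adjoint L) =
      L.det • star ψ := by
  ext v
  simp only [ContinuousAlternatingMap.compContinuousLinearMap_apply, star_apply,
    ContinuousAlternatingMap.smul_apply, smul_eq_mul, Function.comp_def]
  have h := sum_apply_comp_mul ψ.toMultilinearMap
    (volRight (fun i => ContinuousLinearMap.adjoint L (v i))).toMultilinearMap L
  simp only [AlternatingMap.coe_multilinearMap] at h
  erw [h]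
  rw [← mul_div_assoc, Finset.mul_sum]
  congr 1
  refine Finset.sum_congr rfl fun r _ => ?_
  have h2 := vol_comp (ContinuousLinearMap.adjoint L) (Sum.elim v fun i => stdB (r i))
  rw [det_adjoint] at h2
  have h3 : (fun i => ContinuousLinearMap.adjoint L (Sum.elim v (fun i => stdB (r i)) i)) =
    Sum.elim (fun i => ContinuousLinearMap.adjoint L (v i))
      (fun i => ContinuousLinearMap.adjoint L (stdB (r i))) := by
    funext i; cases i <;> rfl
  rw [h3] at h2
  change ψ _ * vol _ = L.det * (ψ _ * vol _)
  rw [h2]; ring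

theorem dx_stdB {k : ℕ} (s : Fin k → Fin 7) (r : Fin k → Fin 7) :
    dx s (fun i => stdB (r i)) =
      ∑ σ : Equiv.Perm (Fin k), (Equiv.Perm.sign σ : ℝ) *
        if (fun i => r (σ i)) = s then 1 else 0 := by
  rw [dx_apply, Matrix.det_apply']
  refine Finset.sum_congr rfl fun σ _ => ?_
  congr 1
  simp only [Matrix.of_apply, EuclideanSpace.basisFun_apply, PiLp.single_apply]
  rw [Finset.prod_ite_zero]
  simp [funext_iff, eq_comm]

/-- Contraction with `dx s` evaluates a form at the basis vectors of index `s`, up to the number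
`k!` of orderings of `s`. -/
theorem sum_dx_mul {k : ℕ} (s : Fin k → Fin 7) (χ : E7 [⋀^Fin k]→ₗ[ℝ] ℝ) :
    ∑ r : Fin k → Fin 7, dx s (fun i => stdB (r i)) * χ (fun i => stdB (r i)) =
      k.factorial * χ (fun i => stdB (s i)) := by
  simp_rw [dx_stdB, Finset.sum_mul]
  rw [Finset.sum_comm]
  have : ∀ σ : Equiv.Perm (Fin k), ∑ r : Fin k → Fin 7,
      ((Equiv.Perm.sign σ : ℝ) * if (fun i => r (σ i)) = s then 1 else 0) *
        χ (fun i => stdB (r i)) = χ (fun i => stdB (s i)) := by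
    intro σ
    rw [Finset.sum_eq_single (fun i => s (σ⁻¹ i))]
    · have h := χ.map_perm (fun i => stdB (s i)) σ⁻¹
      simp only [Function.comp_def] at h
      rw [h, Equiv.Perm.sign_inv]
      rcases Int.units_eq_one_or (Equiv.Perm.sign σ) with h' | h' <;> simp [h']
    · intro r _ hr
      rw [if_neg, mul_zero, zero_mul]
      rintro rfl
      exact hr (by simp)
    · simp
  simp_rw [this]
  simp [Fintype.card_perm]

/-- The volume form as a determinant, for any splitting of the seven coordinates. -/
theorem vol_eq_mul_det (e : Fin 3 ⊕ Fin 4 ≃ Fin 7) (x : Fin 3 ⊕ Fin 4 → E7) :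
    vol x = (Equiv.Perm.sign ((finSumFinEquiv (m := 3) (n := 4)).symm.trans e) : ℝ) *
      (Matrix.of fun i j => x j (e i)).det := by
  rw [vol, Module.Basis.det_apply]
  have h : (stdB.toBasis.reindex (finSumFinEquiv (m := 3) (n := 4)).symm).toMatrix x =
    (Matrix.of fun i j => x j (e i)).submatrix (finSumFinEquiv.trans e.symm) id := by
    ext i j
    simp [Module.Basis.toMatrix_apply]
  rw [h, Matrix.det_permute]
  have h' := Equiv.Perm.sign_trans_trans_symm
    ((finSumFinEquiv (m := 3) (n := 4)).symm.trans e) finSumFinEquiv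
  rw [← Equiv.trans_assoc, Equiv.self_trans_symm, Equiv.refl_trans] at h'
  rw [← h', ← Equiv.Perm.sign_inv]
  rfl

theorem vol_sumElim_stdB (e : Fin 3 ⊕ Fin 4 ≃ Fin 7) (w : Fin 4 → E7) :
    vol (Sum.elim (fun i => stdB (e (Sum.inl i))) w) =
      (Equiv.Perm.sign ((finSumFinEquiv (m := 3) (n := 4)).symm.trans e) : ℝ) *
        dx (fun i => e (Sum.inr i)) w := by
  rw [vol_eq_mul_det e, dx_apply]
  congr 1
  have h : (Matrix.of fun i j => Sum.elim (fun i => stdB (e (Sum.inl i))) w j (e i)) =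
      Matrix.fromBlocks 1 (Matrix.of fun i j => w j (e (Sum.inl i))) 0
        (Matrix.of fun i j => w j (e (Sum.inr i))) := by
    ext i j
    rcases i with i | i <;> rcases j with j | j <;> simp [Matrix.one_apply]
  rw [h, Matrix.det_fromBlocks_zero₂₁, Matrix.det_one, one_mul, ← Matrix.det_transpose]
  rfl

theorem vol_sumElim_stdB' (e : Fin 3 ⊕ Fin 4 ≃ Fin 7) (v : Fin 3 → E7) :
    vol (Sum.elim v fun i => stdB (e (Sum.inr i))) =
      (Equiv.Perm.sign ((finSumFinEquiv (m := 3) (n := 4)).symm.trans e) : ℝ) *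
        dx (fun i => e (Sum.inl i)) v := by
  rw [vol_eq_mul_det e, dx_apply]
  congr 1
  have h : (Matrix.of fun i j => Sum.elim v (fun i => stdB (e (Sum.inr i))) j (e i)) =
      Matrix.fromBlocks (Matrix.of fun i j => v j (e (Sum.inl i))) 0
        (Matrix.of fun i j => v j (e (Sum.inr i))) 1 := by
    ext i j
    rcases i with i | i <;> rcases j with j | j <;> simp [Matrix.one_apply]
  rw [h, Matrix.det_fromBlocks_zero₁₂, Matrix.det_one, mul_one, ← Matrix.det_transpose]
  rfl

theorem star_dx (e : Fin 3 ⊕ Fin 4 ≃ Fin 7) :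
    star (dx fun i => e (Sum.inr i)) =
      (Equiv.Perm.sign ((finSumFinEquiv (m := 3) (n := 4)).symm.trans e) : ℝ) •
        dx fun i => e (Sum.inl i) := by
  ext v
  rw [star_apply, sum_dx_mul, show ((Nat.factorial 4 : ℕ) : ℝ) = 24 by norm_num [Nat.factorial],
    mul_div_cancel_left₀ _ (by norm_num)]
  exact vol_sumElim_stdB' e v

/-- Up to sign, `star` permutes the coefficients. -/
theorem star_injective : Function.Injective star := by
  rw [injective_iff_map_eq_zero]
  intro ψ hψ
  apply ContinuousAlternatingMap.toAlternatingMap_injective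
  refine stdB.toBasis.ext_alternating fun s hs => ?_
  classical
  have hcard : Fintype.card (Fin 3) = Fintype.card ((Set.range s)ᶜ : Set (Fin 7)) := by
    rw [Fintype.card_compl_set, Set.card_range_of_injective hs]
    simp
  let e : Fin 3 ⊕ Fin 4 ≃ Fin 7 :=
    ((Fintype.equivOfCardEq hcard).sumCongr (Equiv.ofInjective s hs)).trans
      ((Equiv.sumComm _ _).trans (Equiv.Set.sumCompl (Set.range s)))
  have hes : (fun i => e (Sum.inr i)) = s := funext fun i => by simp [e]
  have h : star ψ (fun i => stdB (e (Sum.inl i))) = 0 := by rw [hψ]; rfl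
  have hsgn : (Equiv.Perm.sign ((finSumFinEquiv (m := 3) (n := 4)).symm.trans e) : ℝ) ≠ 0 := by
    simp
  have hv : ∀ w, volRight (fun i => stdB (e (Sum.inl i))) w = _ := vol_sumElim_stdB e
  have hd := sum_dx_mul s ψ.toAlternatingMap
  rw [star_apply] at h
  simp_rw [hv, hes, mul_left_comm, ← Finset.mul_sum] at h
  simp only [mul_comm (dx s _)] at hd
  erw [hd] at h
  simp only [div_eq_zero_iff, mul_eq_zero, hsgn, false_or] at h
  norm_num [Nat.factorial] at h
  simpa using h

/-- The splitting of the seven indices given by two lists and the position of each index. -/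
def splitting (t : Fin 3 → Fin 7) (s : Fin 4 → Fin 7) (p : Fin 7 → Fin 3 ⊕ Fin 4)
    (h : Function.LeftInverse p (Sum.elim t s) := by decide)
    (h' : Function.RightInverse p (Sum.elim t s) := by decide) :
    Fin 3 ⊕ Fin 4 ≃ Fin 7 := ⟨Sum.elim t s, p, h, h'⟩

theorem star_dx_of_even (e : Fin 3 ⊕ Fin 4 ≃ Fin 7)
    (h : Equiv.Perm.sign ((finSumFinEquiv (m := 3) (n := 4)).symm.trans e) = 1 := by decide) :
    star (dx fun i => e (Sum.inr i)) = dx fun i => e (Sum.inl i) := by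
  rw [star_dx, h, Units.val_one, Int.cast_one, one_smul]

theorem star_starPhi0 : star starPhi0 = phi0 := by
  have h1 := star_dx_of_even (splitting ![0, 1, 2] ![3, 4, 5, 6]
    ![.inl 0, .inl 1, .inl 2, .inr 0, .inr 1, .inr 2, .inr 3])
  have h2 := star_dx_of_even (splitting ![0, 3, 4] ![1, 2, 5, 6]
    ![.inl 0, .inr 0, .inr 1, .inl 1, .inl 2, .inr 2, .inr 3])
  have h3 := star_dx_of_even (splitting ![0, 5, 6] ![1, 2, 3, 4]
    ![.inl 0, .inr 0, .inr 1, .inr 2, .inr 3, .inl 1, .inl 2])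
  have h4 := star_dx_of_even (splitting ![1, 3, 5] ![0, 2, 4, 6]
    ![.inr 0, .inl 0, .inr 1, .inl 1, .inr 2, .inl 2, .inr 3])
  have h5 := star_dx_of_even (splitting ![1, 4, 6] ![0, 2, 3, 5]
    ![.inr 0, .inl 0, .inr 1, .inr 2, .inl 1, .inr 3, .inl 2])
  have h6 := star_dx_of_even (splitting ![2, 3, 6] ![0, 1, 4, 5]
    ![.inr 0, .inr 1, .inl 0, .inl 1, .inr 2, .inr 3, .inl 2])
  have h7 := star_dx_of_even (splitting ![2, 4, 5] ![0, 1, 3, 6]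
    ![.inr 0, .inr 1, .inl 0, .inr 2, .inl 1, .inl 2, .inr 3])
  simp only [splitting, Equiv.coe_fn_mk, Sum.elim_inl, Sum.elim_inr] at h1 h2 h3 h4 h5 h6 h7
  simp only [starPhi0, phi0, map_add, map_sub, h1, h2, h3, h4, h5, h6, h7]

/-! ### A determinant attached to a 3-form, and the stabilizers -/

/-- The operator `x ↦ w × x + ⟪b, x⟫ b`. -/
def crossAdd (w b : E7) : E7 →ₗ[ℝ] E7 where
  toFun x := cross w x + ⟪b, x⟫ • b
  map_add' x y := by rw [cross_add_right, inner_add_right, add_smul]; abel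
  map_smul' c x := by
    rw [cross_smul_right, inner_smul_right, RingHom.id_apply, smul_add, mul_smul]

theorem crossAdd_apply (w b x : E7) : crossAdd w b x = cross w x + ⟪b, x⟫ • b := rfl

/-- The square of this operator is a multiple of a map `1 + f ⊗ w`, by `cross_cross_self`. -/
theorem det_crossAdd_smul_sq (w : E7) (hw : ⟪w, w⟫ ≠ 0) (c : ℝ) :
    LinearMap.det (crossAdd w (c • w)) ^ 2 = ⟪w, w⟫ ^ 8 * c ^ 4 := by
  have h : crossAdd w (c • w) ∘ₗ crossAdd w (c • w) = (-⟪w, w⟫) •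
      LinearMap.transvection (-((1 + c ^ 4 * ⟪w, w⟫) / ⟪w, w⟫) • (innerₛₗ ℝ w)) w := by
    ext1 x
    simp only [LinearMap.comp_apply, crossAdd_apply, LinearMap.smul_apply,
      LinearMap.transvection.apply, cross_add_right, cross_smul_right, cross_self, cross_cross_self,
      inner_add_right, inner_smul_left, inner_smul_right, innerₛₗ_apply_apply]
    rw [real_inner_comm (cross w x) w, inner_cross_left]
    simp only [conj_trivial, smul_eq_mul, smul_zero, smul_add, mul_zero, zero_add, add_zero,
      smul_smul]
    match_scalars <;> field_simp
  rw [pow_two, ← LinearMap.det_comp, h, LinearMap.det_smul, LinearMap.transvection.det]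
  simp only [LinearMap.smul_apply, innerₛₗ_apply_apply, smul_eq_mul, finrank_euclideanSpace,
    Fintype.card_fin]
  field_simp
  ring

theorem det_crossAdd_sq (w b : E7) (hw : ⟪w, w⟫ ≠ 0) (hb : ⟪b, w⟫ ≠ 0) :
    LinearMap.det (crossAdd w b) ^ 2 = ⟪w, w⟫ ^ 4 * ⟪b, w⟫ ^ 4 := by
  set c := ⟪b, w⟫ / ⟪w, w⟫ with hc
  set η := ⟪b, w⟫⁻¹ • (b - c • w) with hη
  have hηw : ⟪η, w⟫ = 0 := by
    rw [hη, inner_smul_left, inner_sub_left, inner_smul_left, hc]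
    simp only [conj_trivial]
    field_simp
    ring
  have hbη : b - ⟪b, w⟫ • η = c • w := by
    rw [hη, smul_smul, mul_inv_cancel₀ hb, one_smul, sub_sub_cancel]
  clear_value η
  -- A shear along `w` does not change `w × ·` and turns `b` into a multiple of `w`.
  have h : (LinearMap.transvection (innerₛₗ ℝ w) (-η)) ∘ₗ crossAdd w b ∘ₗ
      (LinearMap.transvection (innerₛₗ ℝ (-η)) w) = crossAdd w (c • w) := by
    ext1 x
    have e1 : ∀ x, ⟪w, cross w x⟫ = 0 := fun x => by rw [real_inner_comm, inner_cross_left]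
    have e2 : ⟪b, x⟫ - ⟪η, x⟫ * ⟪b, w⟫ = ⟪c • w, x⟫ := by
      rw [← hbη, inner_sub_left, inner_smul_left, conj_trivial, mul_comm]
    simp only [LinearMap.comp_apply, crossAdd_apply, LinearMap.transvection.apply, cross_add_right,
      cross_smul_right, cross_self, inner_add_right, inner_smul_right, inner_neg_left,
      innerₛₗ_apply_apply, e1, smul_zero, add_zero, zero_add, ← e2]
    rw [← hbη, real_inner_comm b w]
    module
  have h' := congrArg LinearMap.det h
  rw [LinearMap.det_comp, LinearMap.det_comp, LinearMap.transvection.det,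
    LinearMap.transvection.det, innerₛₗ_apply_apply, innerₛₗ_apply_apply, inner_neg_left,
    inner_neg_right, real_inner_comm, hηw] at h'
  simp only [neg_zero, add_zero, one_mul, mul_one] at h'
  rw [h', det_crossAdd_smul_sq w hw, hc]
  field_simp

/-- The determinant of the bilinear form `φ (u, ·, ·) + ⟪u, ·⟫ ⟪u, ·⟫`. It vanishes for a
nonzero `u` exactly if `φ (u, ·, ·)` is degenerate on a complement of `u`. -/
def contrDet (φ : E7 [⋀^Fin 3]→L[ℝ] ℝ) (u : E7) : ℝ :=
  (Matrix.of fun i j => φ ![u, stdB i, stdB j] + ⟪u, stdB i⟫ * ⟪u, stdB j⟫).det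

theorem continuous_contrDet :
    Continuous fun p : (E7 [⋀^Fin 3]→L[ℝ] ℝ) × E7 => contrDet p.1 p.2 := by
  refine Continuous.matrix_det (continuous_matrix fun i j => ?_)
  simp only [Matrix.of_apply]
  have h : Continuous fun p : (E7 [⋀^Fin 3]→L[ℝ] ℝ) × E7 => ![p.2, stdB i, stdB j] := by
    fun_prop
  exact (continuous_fst.eval h).add (by fun_prop)

theorem phi0_comp_apply (L : E7 →L[ℝ] E7) (a b c : E7) :
    (phi0 ⊙ L) ![a, b, c] = ⟪cross (L a) (L b), L c⟫ := by
  rw [ContinuousAlternatingMap.compContinuousLinearMap_apply, phi0_apply]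
  rfl

theorem det_id : (ContinuousLinearMap.id ℝ E7).det = 1 := LinearMap.det_id

theorem det_comp (A B : E7 →L[ℝ] E7) : (A ∘L B).det = A.det * B.det :=
  LinearMap.det_comp (A : E7 →ₗ[ℝ] E7) (B : E7 →ₗ[ℝ] E7)

theorem det_smul (c : ℝ) (A : E7 →L[ℝ] E7) : (c • A).det = c ^ 7 * A.det := by
  have h := LinearMap.det_smul c (A : E7 →ₗ[ℝ] E7)
  rwa [finrank_euclideanSpace, Fintype.card_fin] at h

theorem bijective_of_det_ne_zero {L : E7 →L[ℝ] E7} (hL : L.det ≠ 0) : Function.Bijective L :=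
  (Module.End.isUnit_iff _).1 (LinearMap.isUnit_iff_isUnit_det _ |>.2 (isUnit_iff_ne_zero.2 hL))

/-- On the orbit of `phi0`, the determinant `contrDet` measures the size of the linear map. -/
theorem contrDet_phi0_comp (L : E7 →L[ℝ] E7) (hL : L.det ≠ 0) {u : E7} (hu : u ≠ 0) :
    contrDet (phi0 ⊙ L) u ^ 2 = L.det ^ 4 * ⟪L u, L u⟫ ^ 4 * ⟪u, u⟫ ^ 4 := by
  obtain ⟨β, hβ⟩ : ∃ β, ContinuousLinearMap.adjoint L β = u :=
    (bijective_of_det_ne_zero (by rwa [det_adjoint])).surjective u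
  have hβu : ⟪β, L u⟫ = ⟪u, u⟫ := by rw [← ContinuousLinearMap.adjoint_inner_left, hβ]
  have hmat : contrDet (phi0 ⊙ L) u = LinearMap.det
      (((ContinuousLinearMap.adjoint L : E7 →L[ℝ] E7) : E7 →ₗ[ℝ] E7) ∘ₗ crossAdd (L u) β ∘ₗ
        (L : E7 →ₗ[ℝ] E7)) := by
    rw [← LinearMap.det_toMatrix stdB.toBasis, ← Matrix.det_transpose, contrDet]
    congr 1
    ext i j
    rw [Matrix.of_apply, Matrix.transpose_apply, LinearMap.toMatrix_apply, phi0_comp_apply,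
      OrthonormalBasis.coe_toBasis_repr_apply, OrthonormalBasis.repr_apply_apply,
      OrthonormalBasis.coe_toBasis]
    simp only [LinearMap.comp_apply, ContinuousLinearMap.coe_coe, crossAdd_apply,
      ContinuousLinearMap.adjoint_inner_right, inner_add_right, inner_smul_right]
    have hβ' : ∀ x, ⟪β, L x⟫ = ⟪u, x⟫ := fun x => by
      rw [← ContinuousLinearMap.adjoint_inner_left, hβ]
    rw [real_inner_comm β (L _), hβ', hβ', real_inner_comm (L (stdB j))]
  rw [hmat, LinearMap.det_comp, LinearMap.det_comp, mul_pow, mul_pow, det_crossAdd_sq, hβu]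
  · have := det_adjoint L
    rw [ContinuousLinearMap.det] at this
    rw [this, ContinuousLinearMap.det]
    ring
  · rw [inner_self_ne_zero, Ne, ← map_zero L]
    exact fun h => hu ((bijective_of_det_ne_zero hL).injective h)
  · rw [hβu]; exact inner_self_ne_zero.2 hu

/-- The stabilizer of `phi0` consists of isometries. -/
theorem inner_of_phi0_comp_eq {L : E7 →L[ℝ] E7} (hL : L.det ≠ 0) (h : phi0 ⊙ L = phi0)
    (u v : E7) : ⟪L u, L v⟫ = ⟪u, v⟫ := by
  have hsq : ∀ u, |L.det| * ⟪L u, L u⟫ = ⟪u, u⟫ := by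
    intro u
    rcases eq_or_ne u 0 with rfl | hu
    · simp
    have h1 := contrDet_phi0_comp L hL hu
    have hid : phi0 ⊙ (ContinuousLinearMap.id ℝ E7) = phi0 := rfl
    have h2 := contrDet_phi0_comp (ContinuousLinearMap.id ℝ E7) (by simp [det_id]) hu
    rw [h, ← hid, h2] at h1
    have hpos : ⟪u, u⟫ ^ 4 ≠ 0 := pow_ne_zero _ (inner_self_ne_zero.2 hu)
    have h3 := mul_right_cancel₀ hpos h1
    rw [det_id, one_pow, one_mul, ContinuousLinearMap.id_apply,
      ← (show Even 4 by decide).pow_abs L.det, ← mul_pow] at h3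
    exact ((pow_left_inj₀ (real_inner_self_nonneg) (mul_nonneg (abs_nonneg _)
      real_inner_self_nonneg) (by norm_num)).1 h3).symm
  have hpol : ∀ u v, |L.det| * ⟪L u, L v⟫ = ⟪u, v⟫ := by
    intro u v
    have h1 := hsq (u + v)
    rw [map_add, real_inner_add_add_self, real_inner_add_add_self] at h1
    linarith [hsq u, hsq v]
  have hcomp : |L.det| • (ContinuousLinearMap.adjoint L ∘L L) = ContinuousLinearMap.id ℝ E7 := by
    ext1 x
    refine ext_inner_left ℝ fun y => ?_
    simp only [smul_apply, ContinuousLinearMap.comp_apply, inner_smul_right,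
      ContinuousLinearMap.adjoint_inner_right, hpol, ContinuousLinearMap.id_apply]
  have hdet := congrArg ContinuousLinearMap.det hcomp
  rw [det_smul, det_comp, det_adjoint, det_id, ← abs_mul_abs_self, ← pow_two, ← pow_add] at hdet
  have habs : |L.det| = 1 := (pow_eq_one_iff_of_nonneg (abs_nonneg _) (by norm_num)).1 hdet
  simpa [habs] using hpol u v

theorem cross_of_phi0_comp_eq {L : E7 →L[ℝ] E7} (hL : L.det ≠ 0) (h : phi0 ⊙ L = phi0)
    (u v : E7) : cross (L u) (L v) = L (cross u v) := by
  refine ext_inner_right ℝ fun y => ?_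
  obtain ⟨w, rfl⟩ := (bijective_of_det_ne_zero hL).surjective y
  rw [inner_of_phi0_comp_eq hL h, ← phi0_comp_apply, h, phi0_apply]
  rfl

theorem phi0_ne_zero : phi0 ≠ 0 := by
  intro h
  have h1 := phi0_apply ![stdB 0, stdB 1, stdB 2]
  rw [h, inner_eq_sum] at h1
  simp [cross] at h1

theorem adjoint_comp_self_of_inner {L : E7 →L[ℝ] E7} (h : ∀ u v, ⟪L u, L v⟫ = ⟪u, v⟫) :
    ContinuousLinearMap.adjoint L ∘L L = ContinuousLinearMap.id ℝ E7 := by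
  ext1 x
  refine ext_inner_left ℝ fun y => ?_
  rw [ContinuousLinearMap.comp_apply, ContinuousLinearMap.adjoint_inner_right, h,
    ContinuousLinearMap.id_apply]

/-- The stabilizer of `phi0` preserves the orientation. An element preserves the metric and
`phi0`, hence also `starPhi0`; but the Hodge star only commutes with isometries of
determinant one. -/
theorem det_eq_one_of_phi0_comp_eq {L : E7 →L[ℝ] E7} (hL : L.det ≠ 0) (h : phi0 ⊙ L = phi0) :
    L.det = 1 := by
  have hinner := inner_of_phi0_comp_eq hL h
  have hψ : starPhi0 ⊙ L = starPhi0 := by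
    ext v
    rw [ContinuousAlternatingMap.compContinuousLinearMap_apply, starPhi0_apply, starPhi0_apply]
    simp only [Function.comp_apply, cross_of_phi0_comp_eq hL h, hinner]
  have h1 := star_comp starPhi0 L
  rw [hψ, star_starPhi0] at h1
  have h2 : (phi0 ⊙ ContinuousLinearMap.adjoint L) ⊙ L = (L.det • phi0) ⊙ L := by rw [h1]
  have h3 : (phi0 ⊙ ContinuousLinearMap.adjoint L) ⊙ L =
      phi0 ⊙ (ContinuousLinearMap.adjoint L ∘L L) := rfl
  have h4 : (L.det • phi0) ⊙ L = L.det • (phi0 ⊙ L) := rfl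
  rw [h3, adjoint_comp_self_of_inner hinner, h4, h] at h2
  have h5 : (1 : ℝ) • phi0 = L.det • phi0 := by rw [one_smul]; exact h2
  exact (smul_left_injective ℝ phi0_ne_zero h5).symm

theorem phi0_comp_smul (c : ℝ) (L : E7 →L[ℝ] E7) : phi0 ⊙ (c • L) = c ^ 3 • (phi0 ⊙ L) := by
  ext v
  have h : (⇑(c • L) ∘ v) = fun i => c • (L ∘ v) i := rfl
  rw [ContinuousAlternatingMap.compContinuousLinearMap_apply, h]
  have := phi0.toMultilinearMap.map_smul_univ (fun _ => c) (L ∘ v)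
  simpa using this

/-- The orientation-preserving stabilizer of `starPhi0` is contained in that of `phi0`. -/
theorem phi0_comp_eq_of_starPhi0_comp_eq {L : E7 →L[ℝ] E7} (hL : 0 < L.det)
    (h : starPhi0 ⊙ L = starPhi0) : phi0 ⊙ L = phi0 := by
  have h1 := star_comp starPhi0 L
  rw [h, star_starPhi0] at h1
  -- A multiple of the adjoint preserves `phi0`, hence has determinant one; so the factor is one.
  obtain ⟨c, hc, hc3⟩ : ∃ c : ℝ, 0 < c ∧ c ^ 3 = L.det⁻¹ :=
    ⟨(L.det⁻¹) ^ ((3 : ℕ) : ℝ)⁻¹, by positivity,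
      Real.rpow_inv_natCast_pow (by positivity) (by norm_num)⟩
  set N := c • ContinuousLinearMap.adjoint L with hN
  have hNdet : N.det = c ^ 7 * L.det := by rw [hN, det_smul, det_adjoint]
  have hNphi : phi0 ⊙ N = phi0 := by
    rw [hN, phi0_comp_smul, h1, smul_smul, hc3, inv_mul_cancel₀ hL.ne', one_smul]
  have hN0 : N.det ≠ 0 := by rw [hNdet]; positivity
  have hN1 := det_eq_one_of_phi0_comp_eq hN0 hNphi
  have hc1 : c = 1 := by
    rw [hNdet, show c ^ 7 = c ^ 4 * c ^ 3 by ring, hc3, mul_assoc, inv_mul_cancel₀ hL.ne',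
      mul_one] at hN1
    exact (pow_eq_one_iff_of_nonneg hc.le (by norm_num)).1 hN1
  have hNL : N = ContinuousLinearMap.adjoint L := by rw [hN, hc1, one_smul]
  have h2 := adjoint_comp_self_of_inner (inner_of_phi0_comp_eq hN0 hNphi)
  rw [hNL, ContinuousLinearMap.adjoint_adjoint] at h2
  have h3 : phi0 ⊙ (L ∘L ContinuousLinearMap.adjoint L) = phi0 := by rw [h2]; rfl
  -- `L` is inverse to its adjoint, on either side.
  have h4 : ContinuousLinearMap.adjoint L ∘L L = ContinuousLinearMap.id ℝ E7 := by
    ext1 x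
    have hinj := (bijective_of_det_ne_zero hL.ne').injective
    apply hinj
    exact DFunLike.congr_fun h2 (L x)
  rw [hNL] at hNphi
  have h5 : (phi0 ⊙ ContinuousLinearMap.adjoint L) ⊙ L = phi0 := by
    change phi0 ⊙ (ContinuousLinearMap.adjoint L ∘L L) = phi0
    rw [h4]; rfl
  rwa [hNphi] at h5

/-! ### The orbit of `phi0` is open -/

/-- An endomorphism whose infinitesimal action on `phi0` is the decomposable 3-form `p ∧ q ∧ r`. It
is a combination of `G₂`-equivariant expressions in `p, q, r`, with coefficients fitted to this
requirement. -/
def infGen (p q r : E7) : E7 →L[ℝ] E7 :=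
  (1 / 6 : ℝ) • ((innerSL ℝ (cross q r)).smulRight p + (innerSL ℝ (cross r p)).smulRight q +
    (innerSL ℝ (cross p q)).smulRight r) +
  (1 / 3 : ℝ) • ((innerSL ℝ p).smulRight (cross q r) + (innerSL ℝ q).smulRight (cross r p) +
    (innerSL ℝ r).smulRight (cross p q)) -
  (1 / 6 * ⟪cross p q, r⟫) • ContinuousLinearMap.id ℝ E7

theorem infGen_apply (p q r u : E7) : infGen p q r u =
    (1 / 6 : ℝ) • (⟪cross q r, u⟫ • p + ⟪cross r p, u⟫ • q + ⟪cross p q, u⟫ • r) +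
    (1 / 3 : ℝ) • (⟪p, u⟫ • cross q r + ⟪q, u⟫ • cross r p + ⟪r, u⟫ • cross p q) -
    (1 / 6 * ⟪cross p q, r⟫) • u := rfl

set_option maxHeartbeats 4000000 in
/-- The infinitesimal action of `infGen p q r` on `phi0` is `p ∧ q ∧ r`. Restricting `r` to basis
vectors keeps the polynomial identities small. -/
theorem infGen_action (p q : E7) (c : Fin 7) (u v w : E7) :
    ⟪cross (infGen p q (stdB c) u) v, w⟫ + ⟪cross u (infGen p q (stdB c) v), w⟫ +
      ⟪cross u v, infGen p q (stdB c) w⟫ =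
    ⟪p, u⟫ * (⟪q, v⟫ * w c - v c * ⟪q, w⟫) - ⟪q, u⟫ * (⟪p, v⟫ * w c - v c * ⟪p, w⟫) +
      u c * (⟪p, v⟫ * ⟪q, w⟫ - ⟪q, v⟫ * ⟪p, w⟫) := by
  simp only [inner_eq_sum, infGen_apply]
  fin_cases c <;> simp [cross] <;> ring

theorem dx_stdB_comm {k : ℕ} (s r : Fin k → Fin 7) :
    dx s (fun i => stdB (r i)) = dx r (fun i => stdB (s i)) := by
  rw [dx_apply, dx_apply, ← Matrix.det_transpose]
  congr 1
  ext i j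
  simp [PiLp.single_apply, eq_comm]

theorem ext_stdB {k : ℕ} {θ η : E7 [⋀^Fin k]→L[ℝ] ℝ}
    (h : ∀ s : Fin k → Fin 7, θ (fun i => stdB (s i)) = η (fun i => stdB (s i))) : θ = η := by
  apply ContinuousAlternatingMap.toAlternatingMap_injective
  refine stdB.toBasis.ext_alternating fun s _ => ?_
  simpa using h s

/-- Expansion of a 3-form in coordinates; each set of three indices occurs `3! = 6` times. -/
theorem sum_smul_dx (ρ : E7 [⋀^Fin 3]→L[ℝ] ℝ) :
    ∑ r : Fin 3 → Fin 7, ρ (fun i => stdB (r i)) • dx r = (6 : ℝ) • ρ := by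
  refine ext_stdB fun s => ?_
  have h := sum_dx_mul s ρ.toAlternatingMap
  simp only [dx_stdB_comm s] at h
  rw [show ((Nat.factorial 3 : ℕ) : ℝ) = 6 by norm_num [Nat.factorial]] at h
  have h2 : (∑ r : Fin 3 → Fin 7, ρ (fun i => stdB (r i)) • dx r) (fun i => stdB (s i)) =
      ∑ r : Fin 3 → Fin 7, ρ (fun i => stdB (r i)) * dx r (fun i => stdB (s i)) :=
    ContinuousAlternatingMap.sum_apply _ _
  rw [h2, ContinuousAlternatingMap.smul_apply, smul_eq_mul]
  simp only [mul_comm (ρ _)]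
  exact h

/-- The 3-forms `dx t` span, and they are in the image by `infGen_action`. -/
theorem fderiv_phi0_surjective : Function.Surjective
    (phi0.fderivCompContinuousLinearMap (ContinuousLinearMap.id ℝ E7)) := by
  have hdx : ∀ t : Fin 3 → Fin 7, phi0.fderivCompContinuousLinearMap (ContinuousLinearMap.id ℝ E7)
      (infGen (stdB (t 0)) (stdB (t 1)) (stdB (t 2))) = dx t := by
    intro t
    ext v
    have h := infGen_action (stdB (t 0)) (stdB (t 1)) (t 2) (v 0) (v 1) (v 2)
    rw [ContinuousAlternatingMap.fderivCompContinuousLinearMap_apply, Fin.sum_univ_three]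
    simp only [phi0_apply]
    refine h.trans ?_
    rw [dx_apply, Matrix.det_fin_three]
    simp only [EuclideanSpace.basisFun_inner, Matrix.of_apply]
    ring
  intro ρ
  refine ⟨∑ t : Fin 3 → Fin 7, (ρ (fun i => stdB (t i)) / 6) •
    infGen (stdB (t 0)) (stdB (t 1)) (stdB (t 2)), ?_⟩
  rw [map_sum]
  simp only [map_smul, hdx, div_eq_inv_mul, mul_smul]
  rw [← Finset.smul_sum, sum_smul_dx, smul_smul, inv_mul_cancel₀ (by norm_num), one_smul]

theorem hasStrictFDerivAt_phi0_comp : HasStrictFDerivAt (fun A : E7 →L[ℝ] E7 => phi0 ⊙ A)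
    (phi0.fderivCompContinuousLinearMap (ContinuousLinearMap.id ℝ E7))
    (ContinuousLinearMap.id ℝ E7) := by
  have h := HasStrictFDerivAt.continuousAlternatingMapCompContinuousLinearMap
    (hasStrictFDerivAt_const phi0 (ContinuousLinearMap.id ℝ E7))
    (hasStrictFDerivAt_id (𝕜 := ℝ) (ContinuousLinearMap.id ℝ E7))
  rwa [ContinuousLinearMap.comp_zero, zero_add, ContinuousLinearMap.comp_id] at h

theorem image_phi0_comp_mem_nhds_id {S : Set (E7 →L[ℝ] E7)}
    (hS : S ∈ 𝓝 (ContinuousLinearMap.id ℝ E7)) : (fun A => phi0 ⊙ A) '' S ∈ 𝓝 phi0 := by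
  have h := hasStrictFDerivAt_phi0_comp.map_nhds_eq_of_surj
    (LinearMap.range_eq_top.2 fderiv_phi0_surjective)
  have h' : (fun A => phi0 ⊙ A) '' S ∈
    Filter.map (fun A : E7 →L[ℝ] E7 => phi0 ⊙ A) (𝓝 (ContinuousLinearMap.id ℝ E7)) :=
    Filter.image_mem_map hS
  rwa [h] at h'

theorem continuous_comp_left (L : E7 →L[ℝ] E7) {k : ℕ} :
    Continuous fun ρ : E7 [⋀^Fin k]→L[ℝ] ℝ => ρ ⊙ L :=
  (ContinuousAlternatingMap.compContinuousLinearMapCLM L).continuous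

theorem continuous_comp {k : ℕ} :
    Continuous fun p : (E7 [⋀^Fin k]→L[ℝ] ℝ) × (E7 →L[ℝ] E7) => p.1 ⊙ p.2 := by
  change Continuous fun p : (E7 [⋀^Fin k]→L[ℝ] ℝ) × (E7 →L[ℝ] E7) =>
    ContinuousAlternatingMap.compContinuousLinearMapCLM p.2 p.1
  exact ((ContinuousAlternatingMap.continuous_compContinuousLinearMapCLM (𝕜 := ℝ)).comp
    continuous_snd).clm_apply continuous_fst

/-- The map `A ↦ A^* phi0` is open at invertible linear maps. -/
theorem image_phi0_comp_mem_nhds (L : E7 ≃L[ℝ] E7) {S : Set (E7 →L[ℝ] E7)}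
    (hS : S ∈ 𝓝 (L : E7 →L[ℝ] E7)) :
    (fun A => phi0 ⊙ A) '' S ∈ 𝓝 (phi0 ⊙ (L : E7 →L[ℝ] E7)) := by
  have h1 : {A : E7 →L[ℝ] E7 | A ∘L (L : E7 →L[ℝ] E7) ∈ S} ∈ 𝓝 (ContinuousLinearMap.id ℝ E7) :=
    (show Continuous fun A : E7 →L[ℝ] E7 => A ∘L (L : E7 →L[ℝ] E7) by fun_prop).continuousAt
      (by rwa [ContinuousLinearMap.id_comp])
  have hphi : (phi0 ⊙ (L : E7 →L[ℝ] E7)) ⊙ (L.symm : E7 →L[ℝ] E7) = phi0 := by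
    ext v
    simp [Function.comp_def]
  have h2 := (continuous_comp_left (L.symm : E7 →L[ℝ] E7)).continuousAt
    (x := phi0 ⊙ (L : E7 →L[ℝ] E7)) (by rw [hphi]; exact image_phi0_comp_mem_nhds_id h1)
  filter_upwards [h2] with ρ hρ
  obtain ⟨A, hA, hAρ⟩ := hρ
  refine ⟨A ∘L (L : E7 →L[ℝ] E7), hA, ?_⟩
  have h3 : (phi0 ⊙ A) ⊙ (L : E7 →L[ℝ] E7) =
    (ρ ⊙ (L.symm : E7 →L[ℝ] E7)) ⊙ (L : E7 →L[ℝ] E7) := congrArg (· ⊙ (L : E7 →L[ℝ] E7)) hAρ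
  refine Eq.trans h3 ?_
  ext v
  simp [Function.comp_def]

/-! ### Tame 3-forms on `ℝ⁷` are positive -/

theorem update_vec_zero {V : Type*} (u x y z : V) :
    Function.update ![u, x, y] 0 z = ![z, x, y] := by
  funext i; fin_cases i <;> rfl

theorem update_vec_one {V : Type*} (u x y z : V) :
    Function.update ![u, x, y] 1 z = ![u, z, y] := by
  funext i; fin_cases i <;> rfl

theorem update_vec_two {V : Type*} (u x y z : V) :
    Function.update ![u, x, y] 2 z = ![u, x, z] := by
  funext i; fin_cases i <;> rfl

section

variable {V : Type*} [AddCommGroup V] [Module ℝ V] [TopologicalSpace V]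

/-- The bilinear form `γ (u, ·, ·)`. -/
def contr (γ : V [⋀^Fin 3]→L[ℝ] ℝ) (u : V) : V →ₗ[ℝ] V →ₗ[ℝ] ℝ :=
  LinearMap.mk₂ ℝ (fun x y => γ ![u, x, y])
    (fun x x' y => by simpa only [update_vec_one] using γ.map_update_add ![u, x, y] 1 x x')
    (fun c x y => by simpa only [update_vec_one] using γ.map_update_smul ![u, x, y] 1 c x)
    (fun x y y' => by simpa only [update_vec_two] using γ.map_update_add ![u, x, y] 2 y y')
    (fun c x y => by simpa only [update_vec_two] using γ.map_update_smul ![u, x, y] 2 c y)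

theorem contr_apply (γ : V [⋀^Fin 3]→L[ℝ] ℝ) (u x y : V) : contr γ u x y = γ ![u, x, y] := rfl

theorem contr_self_left (γ : V [⋀^Fin 3]→L[ℝ] ℝ) (u y : V) : contr γ u u y = 0 :=
  γ.map_eq_zero_of_eq ![u, u, y] (i := 0) (j := 1) rfl (by decide)

theorem contr_self_right (γ : V [⋀^Fin 3]→L[ℝ] ℝ) (u x : V) : contr γ u x u = 0 :=
  γ.map_eq_zero_of_eq ![u, x, u] (i := 0) (j := 2) rfl (by decide)

theorem contr_smul_left (γ : V [⋀^Fin 3]→L[ℝ] ℝ) (c : ℝ) (u x y : V) :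
    contr γ (c • u) x y = c * contr γ u x y := by
  simpa only [contr_apply, update_vec_zero, smul_eq_mul] using γ.map_update_smul ![u, x, y] 0 c u

end

/-- The 3-forms on `ℝ⁷` that are positive on the associative 3-planes of the standard
`G₂`-structure; such a plane has an oriented basis of the form `(u, v, u × v)`. -/
def tameForms : Set (E7 [⋀^Fin 3]→L[ℝ] ℝ) :=
  {γ | ∀ u v, LinearIndependent ℝ ![u, v] → 0 < γ ![u, v, cross u v]}

theorem add_mem_tameForms {γ δ : E7 [⋀^Fin 3]→L[ℝ] ℝ} (hγ : γ ∈ tameForms)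
    (hδ : δ ∈ tameForms) : γ + δ ∈ tameForms :=
  fun u v h => add_pos (hγ u v h) (hδ u v h)

theorem smul_mem_tameForms {γ : E7 [⋀^Fin 3]→L[ℝ] ℝ} (hγ : γ ∈ tameForms) {c : ℝ} (hc : 0 < c) :
    c • γ ∈ tameForms :=
  fun u v h => mul_pos hc (hγ u v h)

theorem convex_tameForms : Convex ℝ tameForms := by
  rw [convex_iff_forall_pos]
  intro γ hγ δ hδ a b ha hb _
  exact add_mem_tameForms (smul_mem_tameForms hγ ha) (smul_mem_tameForms hδ hb)

theorem cross_ne_zero {u v : E7} (h : LinearIndependent ℝ ![u, v]) : cross u v ≠ 0 := by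
  intro h0
  have h1 := cross_cross_self u v
  rw [h0, show cross u 0 = 0 by simpa using cross_smul_right 0 u 0] at h1
  have h2 := LinearIndependent.pair_iff.1 h ⟪u, v⟫ (-⟪u, u⟫)
    (by rw [neg_smul, ← sub_eq_add_neg, ← h1])
  have h3 : u ≠ 0 := h.ne_zero 0
  exact h3 (inner_self_eq_zero.1 (neg_eq_zero.1 h2.2))

theorem phi0_mem_tameForms : phi0 ∈ tameForms := by
  intro u v h
  rw [phi0_apply]
  exact real_inner_self_pos.2 (cross_ne_zero h)

theorem linearIndependent_of_inner_eq_zero {u v : E7} (hu : u ≠ 0) (hv : v ≠ 0)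
    (h : ⟪u, v⟫ = 0) : LinearIndependent ℝ ![u, v] := by
  rw [LinearIndependent.pair_iff]
  intro s t hst
  have h1 : ⟪u, s • u + t • v⟫ = 0 := by rw [hst, inner_zero_right]
  have h2 : ⟪v, s • u + t • v⟫ = 0 := by rw [hst, inner_zero_right]
  rw [inner_add_right, inner_smul_right, inner_smul_right] at h1 h2
  rw [h, mul_zero, add_zero] at h1
  rw [real_inner_comm, h, mul_zero, zero_add] at h2
  exact ⟨(mul_eq_zero.1 h1).resolve_right (inner_self_ne_zero.2 hu),
    (mul_eq_zero.1 h2).resolve_right (inner_self_ne_zero.2 hv)⟩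

/-- If `X` is in the kernel of the bilinear form of `contrDet γ u`, then `X` is orthogonal to `u`,
and `γ` vanishes on the associative frame `(u, X, u × X)`. -/
theorem contrDet_ne_zero {γ : E7 [⋀^Fin 3]→L[ℝ] ℝ} (hγ : γ ∈ tameForms) {u : E7} (hu : u ≠ 0) :
    contrDet γ u ≠ 0 := by
  intro h
  obtain ⟨x, hx, hxM⟩ := Matrix.exists_vecMul_eq_zero_iff.2 h
  set X : E7 := ∑ i, x i • stdB i with hX
  have hXx : ∀ i, X i = x i := fun i => by
    simp [hX, Pi.single_apply]
  have hX0 : X ≠ 0 := by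
    rintro h0
    exact hx (funext fun i => by rw [← hXx, h0]; rfl)
  have h1 : ∀ y : E7, contr γ u X y + ⟪u, X⟫ * ⟪u, y⟫ = 0 := by
    have h2 : contr γ u X + ⟪u, X⟫ • innerₛₗ ℝ u = 0 := by
      refine stdB.toBasis.ext fun j => ?_
      have h3 := congrFun hxM j
      simp only [Matrix.vecMul, dotProduct, Matrix.of_apply, Pi.zero_apply, mul_add,
        Finset.sum_add_distrib] at h3
      rw [OrthonormalBasis.coe_toBasis, LinearMap.zero_apply, ← h3, hX, map_sum, inner_sum]
      simp only [LinearMap.add_apply, LinearMap.sum_apply, map_smul, LinearMap.smul_apply,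
        inner_smul_right, smul_eq_mul, innerₛₗ_apply_apply, Finset.sum_mul, contr_apply, mul_assoc]
    intro y
    simpa using LinearMap.congr_fun h2 y
  have huX : ⟪u, X⟫ = 0 := by
    have := h1 u
    rw [contr_self_right, zero_add] at this
    exact (mul_eq_zero.1 this).resolve_right (inner_self_ne_zero.2 hu)
  have h4 := h1 (cross u X)
  rw [huX, zero_mul, add_zero] at h4
  exact (hγ u X (linearIndependent_of_inner_eq_zero hu hX0 huX)).ne' h4

/-- The orthonormal pairs of vectors. -/
def orthoPairs : Set (E7 × E7) := {p | ‖p.1‖ = 1 ∧ ‖p.2‖ = 1 ∧ ⟪p.1, p.2⟫ = 0}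

theorem isCompact_orthoPairs : IsCompact orthoPairs := by
  refine (isCompact_closedBall (0 : E7 × E7) 1).of_isClosed_subset ?_ ?_
  · exact (isClosed_eq (by fun_prop) (by fun_prop)).inter
      ((isClosed_eq (by fun_prop) (by fun_prop)).inter (isClosed_eq (by fun_prop) (by fun_prop)))
  · rintro ⟨u, v⟩ ⟨h1, h2, -⟩
    simp only at h1 h2
    simp [Prod.norm_def, h1, h2]

theorem continuous_cross : Continuous fun p : E7 × E7 => cross p.1 p.2 := by
  unfold cross
  fun_prop

/-- The second vector of an associative frame can be made orthogonal to the first. -/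
theorem exists_orth_of_linearIndependent {u v : E7} (huv : LinearIndependent ℝ ![u, v]) :
    ∃ w : E7, w ≠ 0 ∧ ⟪u, w⟫ = 0 ∧
      ∀ γ : E7 [⋀^Fin 3]→L[ℝ] ℝ, γ ![u, v, cross u v] = γ ![u, w, cross u w] := by
  have huu : ⟪u, u⟫ ≠ 0 := inner_self_ne_zero.2 (huv.ne_zero 0)
  set c := ⟪u, v⟫ / ⟪u, u⟫ with hc
  refine ⟨v - c • u, ?_, ?_, fun γ => ?_⟩
  · intro h0
    have := LinearIndependent.pair_iff.1 huv (-c) 1 (by rw [← h0]; module)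
    exact one_ne_zero this.2
  · rw [inner_sub_right, inner_smul_right, hc, div_mul_cancel₀ _ huu, sub_self]
  · have hv : v = (v - c • u) + c • u := by rw [sub_add_cancel]
    conv_lhs => rw [hv]
    rw [← contr_apply, ← contr_apply, cross_add_right, cross_smul_right, cross_self, smul_zero,
      add_zero, map_add, map_smul, LinearMap.add_apply, LinearMap.smul_apply, contr_self_left,
      smul_zero, add_zero]

theorem mem_tameForms_iff {γ : E7 [⋀^Fin 3]→L[ℝ] ℝ} :
    γ ∈ tameForms ↔ ∀ p ∈ orthoPairs, 0 < γ ![p.1, p.2, cross p.1 p.2] := by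
  constructor
  · rintro h ⟨u, v⟩ ⟨h1, h2, h3⟩
    exact h u v (linearIndependent_of_inner_eq_zero (norm_ne_zero_iff.1 (by rw [h1]; simp))
      (norm_ne_zero_iff.1 (by rw [h2]; simp)) h3)
  · intro h u v huv
    have hu : u ≠ 0 := huv.ne_zero 0
    obtain ⟨w, hw0, huw, hw⟩ := exists_orth_of_linearIndependent huv
    have hnu := norm_pos_iff.2 hu
    have hnw := norm_pos_iff.2 hw0
    have h1 := h (‖u‖⁻¹ • u, ‖w‖⁻¹ • w) ⟨by simp [norm_smul, hnu.ne'],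
      by simp [norm_smul, hnw.ne'], by simp [inner_smul_left, inner_smul_right, huw]⟩
    simp only [← contr_apply, contr_smul_left, cross_smul_left, cross_smul_right, map_smul,
      LinearMap.smul_apply, smul_eq_mul] at h1
    rw [hw, ← contr_apply]
    have h2 : 0 < ‖u‖⁻¹ * ‖u‖⁻¹ * ‖w‖⁻¹ * ‖w‖⁻¹ := by positivity
    refine pos_of_mul_pos_right (lt_of_lt_of_eq h1 ?_) h2.le
    ring

theorem isOpen_tameForms : IsOpen tameForms := by
  rw [isOpen_iff_mem_nhds]
  intro γ hγ
  have hcont : Continuous fun z : (E7 [⋀^Fin 3]→L[ℝ] ℝ) × (E7 × E7) =>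
      z.1 ![z.2.1, z.2.2, cross z.2.1 z.2.2] := by
    have h := continuous_cross
    have h' : Continuous fun z : (E7 [⋀^Fin 3]→L[ℝ] ℝ) × (E7 × E7) =>
        ![z.2.1, z.2.2, cross z.2.1 z.2.2] := by
      fun_prop
    exact continuous_fst.eval h'
  have h := isCompact_orthoPairs.eventually_forall_of_forall_eventually (x₀ := γ)
    (P := fun γ p => 0 < γ ![p.1, p.2, cross p.1 p.2]) fun p hp =>
      hcont.continuousAt.eventually (lt_mem_nhds (mem_tameForms_iff.1 hγ p hp))
  filter_upwards [h] with δ hδ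
  exact mem_tameForms_iff.2 hδ

/-- The orbit of `phi0` under the linear maps of positive determinant. -/
def posOrbit : Set (E7 [⋀^Fin 3]→L[ℝ] ℝ) := {ρ | ∃ L : E7 →L[ℝ] E7, 0 < L.det ∧ phi0 ⊙ L = ρ}

/-- A linear map with nonzero determinant as an equivalence. -/
def equivOfDet (L : E7 →L[ℝ] E7) (hL : L.det ≠ 0) : E7 ≃L[ℝ] E7 :=
  (LinearEquiv.ofBijective (L : E7 →ₗ[ℝ] E7)
    (bijective_of_det_ne_zero hL)).toContinuousLinearEquiv

theorem coe_equivOfDet (L : E7 →L[ℝ] E7) (hL : L.det ≠ 0) :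
    (equivOfDet L hL : E7 →L[ℝ] E7) = L := rfl

theorem isOpen_posOrbit : IsOpen posOrbit := by
  rw [isOpen_iff_mem_nhds]
  rintro _ ⟨L, hL, rfl⟩
  have h1 : {A : E7 →L[ℝ] E7 | 0 < A.det} ∈ 𝓝 L :=
    ContinuousLinearMap.continuous_det.continuousAt.eventually (lt_mem_nhds hL)
  rw [← coe_equivOfDet L hL.ne'] at h1 ⊢
  refine Filter.mem_of_superset (image_phi0_comp_mem_nhds _ h1) ?_
  rintro _ ⟨A, hA, rfl⟩
  exact ⟨A, hA, rfl⟩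

theorem lt_of_lt_pow_four {c q : ℝ} (hc : c ≤ 1) (hq : 0 ≤ q)
    (h : c < q ^ 4) : c < q := by
  by_contra! hq'
  have h1 : q ^ 4 ≤ q := pow_le_of_le_one hq (hq'.trans hc) (by norm_num)
  linarith

theorem lt_of_pow_four_lt {C q : ℝ} (hC : 1 ≤ C) (h : q ^ 4 < C) : q < C := by
  by_contra! hq'
  have h1 : q ≤ q ^ 4 := le_self_pow₀ (hC.trans hq') (by norm_num)
  linarith

/-- The limit of positive forms, if it is a tame form, is a positive form: the determinant
`contrDet` bounds the linear maps that carry `phi0` to the forms of the sequence. -/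
theorem mem_posOrbit_of_tendsto {γ : E7 [⋀^Fin 3]→L[ℝ] ℝ} (hγ : γ ∈ tameForms)
    {L : ℕ → E7 →L[ℝ] E7} (hL : ∀ n, 0 < (L n).det)
    (hlim : Filter.Tendsto (fun n => phi0 ⊙ L n) Filter.atTop (𝓝 γ)) : γ ∈ posOrbit := by
  have hS : IsCompact (Metric.sphere (0 : E7) 1) := isCompact_sphere 0 1
  have hne : (Metric.sphere (0 : E7) 1).Nonempty := ⟨stdB 0, by simp⟩
  have hcont₁ : Continuous fun u => contrDet γ u := by
    simpa [Function.comp_def] using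
      continuous_contrDet.comp (Continuous.prodMk (continuous_const (y := γ)) continuous_id)
  have hcont : Continuous fun u => contrDet γ u ^ 2 := hcont₁.pow 2
  have hpos : ∀ u ∈ Metric.sphere (0 : E7) 1, 0 < contrDet γ u ^ 2 := by
    intro u hu
    exact sq_pos_iff.2 (contrDet_ne_zero hγ (ne_zero_of_mem_unit_sphere ⟨u, hu⟩))
  obtain ⟨u₁, hu₁, hmin⟩ := hS.exists_isMinOn hne hcont.continuousOn
  obtain ⟨u₂, hu₂, hmax⟩ := hS.exists_isMaxOn hne hcont.continuousOn
  obtain ⟨c, hc0, hc1, hc⟩ : ∃ c : ℝ, 0 < c ∧ c ≤ 1 ∧ c < contrDet γ u₁ ^ 2 := by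
    refine ⟨min 1 (contrDet γ u₁ ^ 2 / 2), ?_, min_le_left _ _, ?_⟩
    · exact lt_min one_pos (half_pos (hpos u₁ hu₁))
    · exact (min_le_right _ _).trans_lt (half_lt_self (hpos u₁ hu₁))
  obtain ⟨C, hC1, hC⟩ : ∃ C : ℝ, 1 ≤ C ∧ contrDet γ u₂ ^ 2 < C :=
    ⟨max 1 (contrDet γ u₂ ^ 2 + 1), le_max_left _ _, (lt_add_one _).trans_le (le_max_right _ _)⟩
  have hev : ∀ᶠ δ in 𝓝 γ, ∀ u ∈ Metric.sphere (0 : E7) 1,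
      c < contrDet δ u ^ 2 ∧ contrDet δ u ^ 2 < C := by
    refine hS.eventually_forall_of_forall_eventually
      (P := fun δ u => c < contrDet δ u ^ 2 ∧ contrDet δ u ^ 2 < C) fun u hu => ?_
    have h1 : ContinuousAt (fun z : (E7 [⋀^Fin 3]→L[ℝ] ℝ) × E7 => contrDet z.1 z.2 ^ 2) (γ, u) :=
      (continuous_contrDet.pow 2).continuousAt
    exact (h1.eventually (lt_mem_nhds (hc.trans_le (hmin hu)))).and
      (h1.eventually (gt_mem_nhds ((hmax hu).trans_lt hC)))
  -- By `contrDet_phi0_comp`, the square of `contrDet` at a unit vector `u` is the fourth power of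
  -- `det L * ‖L u‖ ^ 2`. So the maps are bounded above and below after scaling by `√(det L)`.
  set δ : ℕ → ℝ := fun n => √((L n).det) with hδ
  have hδ0 : ∀ n, 0 < δ n := fun n => Real.sqrt_pos.2 (hL n)
  have hδ2 : ∀ n, δ n ^ 2 = (L n).det := fun n => Real.sq_sqrt (hL n).le
  have hbound : ∀ᶠ n in Filter.atTop, ∀ u ∈ Metric.sphere (0 : E7) 1,
      c < ‖(δ n • L n) u‖ ^ 2 ∧ ‖(δ n • L n) u‖ ^ 2 < C := by
    filter_upwards [hlim.eventually hev] with n hn u hu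
    have hu1 : ‖u‖ = 1 := by simpa using hu
    have hu0 : u ≠ 0 := norm_ne_zero_iff.1 (by rw [hu1]; simp)
    have h1 := hn u hu
    rw [contrDet_phi0_comp (L n) (hL n).ne' hu0, real_inner_self_eq_norm_sq u, hu1, one_pow,
      one_pow, mul_one, ← mul_pow, ← hδ2, real_inner_self_eq_norm_sq] at h1
    rw [smul_apply, norm_smul, mul_pow, Real.norm_eq_abs, sq_abs]
    exact ⟨lt_of_lt_pow_four hc1 (by positivity) h1.1, lt_of_pow_four_lt hC1 h1.2⟩
  have hball : ∀ᶠ n in Filter.atTop, δ n • L n ∈ Metric.closedBall (0 : E7 →L[ℝ] E7) C := by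
    filter_upwards [hbound] with n hn
    rw [mem_closedBall_zero_iff]
    refine ContinuousLinearMap.opNorm_le_of_unit_norm (by linarith) fun u hu => ?_
    have h1 := (hn u (by simpa using hu)).2
    nlinarith [norm_nonneg ((δ n • L n) u)]
  have : ProperSpace (E7 →L[ℝ] E7) := FiniteDimensional.proper ℝ _
  obtain ⟨M, -, k, hk, hM⟩ := (isCompact_closedBall (0 : E7 →L[ℝ] E7) C).tendsto_subseq'
    hball.frequently
  have hk' := hk.tendsto_atTop
  have hMlow : ∀ u ∈ Metric.sphere (0 : E7) 1, c ≤ ‖M u‖ ^ 2 := by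
    intro u hu
    have h1 : Filter.Tendsto (fun n => ‖(δ (k n) • L (k n)) u‖ ^ 2) Filter.atTop (𝓝 (‖M u‖ ^ 2)) :=
      ((((ContinuousLinearMap.apply ℝ E7 u).continuous.tendsto M).comp hM).norm).pow 2
    refine ge_of_tendsto h1 ?_
    filter_upwards [hk'.eventually hbound] with n hn using (hn u hu).1.le
  have hMdet : M.det ≠ 0 := by
    intro h0
    obtain ⟨x, hx, hx0⟩ : ∃ x : E7, M x = 0 ∧ x ≠ 0 := by
      by_contra! hinj
      have h1 : LinearMap.ker (M : E7 →ₗ[ℝ] E7) = ⊥ := LinearMap.ker_eq_bot'.2 hinj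
      exact (LinearMap.isUnit_iff_isUnit_det _).1
        ((LinearMap.isUnit_iff_ker_eq_bot _).2 h1) |>.ne_zero h0
    have h1 := hMlow (‖x‖⁻¹ • x) (by simp [norm_smul, hx0])
    rw [map_smul, hx, smul_zero, norm_zero] at h1
    norm_num at h1
    linarith
  have hdetlim : Filter.Tendsto (fun n => δ (k n) ^ 9) Filter.atTop (𝓝 M.det) := by
    have h1 := (ContinuousLinearMap.continuous_det.tendsto M).comp hM
    refine h1.congr fun n => ?_
    simp only [Function.comp_apply]
    rw [det_smul, ← hδ2]; ring
  have hMpos : 0 < M.det :=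
    lt_of_le_of_ne (ge_of_tendsto' hdetlim fun n => pow_nonneg (hδ0 _).le 9) hMdet.symm
  obtain ⟨d, hd0, hd⟩ : ∃ d : ℝ, 0 < d ∧ Filter.Tendsto (fun n => δ (k n)) Filter.atTop (𝓝 d) := by
    refine ⟨M.det ^ ((9 : ℕ) : ℝ)⁻¹, by positivity, ?_⟩
    refine (hdetlim.rpow_const (Or.inl hMpos.ne')).congr fun n => ?_
    exact Real.pow_rpow_inv_natCast (hδ0 _).le (by norm_num)
  have hLlim : Filter.Tendsto (fun n => L (k n)) Filter.atTop (𝓝 (d⁻¹ • M)) := by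
    refine ((hd.inv₀ hd0.ne').smul hM).congr fun n => ?_
    simp only [Function.comp_apply]
    rw [smul_smul, inv_mul_cancel₀ (hδ0 _).ne', one_smul]
  refine ⟨d⁻¹ • M, by rw [det_smul]; positivity, ?_⟩
  have h1 : Continuous fun A : E7 →L[ℝ] E7 => phi0 ⊙ A :=
    continuous_comp.comp (by fun_prop : Continuous fun A : E7 →L[ℝ] E7 => (phi0, A))
  exact tendsto_nhds_unique ((h1.tendsto _).comp hLlim) (hlim.comp hk')

/-- A tame 3-form on `ℝ⁷` is positive, and it induces the standard orientation. The tame forms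
are a convex, hence connected, set, and the positive ones are open and closed in it. -/
theorem tameForms_subset_posOrbit : tameForms ⊆ posOrbit := by
  refine convex_tameForms.isPreconnected.subset_of_closure_inter_subset isOpen_posOrbit
    ⟨phi0, phi0_mem_tameForms, ContinuousLinearMap.id ℝ E7, by rw [det_id]; exact one_pos, rfl⟩ ?_
  rintro γ ⟨hcl, hγ⟩
  obtain ⟨ρ, hρ, hlim⟩ := mem_closure_iff_seq_limit.1 hcl
  choose L hL hLρ using hρ
  exact mem_posOrbit_of_tendsto hγ hL (by simpa only [hLρ] using hlim)

/-! ### Transposing a linear map that makes `phi0` tame -/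

/-- A form in the orbit of `phi0` determines the determinant of the map, as the stabilizer of `phi0`
lies in `SL(7)`. -/
theorem det_eq_of_phi0_comp_eq {A B : E7 →L[ℝ] E7} (hA : A.det ≠ 0) (hB : B.det ≠ 0)
    (h : phi0 ⊙ A = phi0 ⊙ B) : A.det = B.det := by
  set e := equivOfDet B hB
  have hB' : (e : E7 →L[ℝ] E7) = B := coe_equivOfDet B hB
  have hcomp : (A ∘L (e.symm : E7 →L[ℝ] E7)) ∘L B = A := by
    rw [← hB']
    ext1 x
    simp
  have hdet : A.det = (A ∘L (e.symm : E7 →L[ℝ] E7)).det * B.det := by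
    rw [← det_comp, hcomp]
  have h1 : phi0 ⊙ (A ∘L (e.symm : E7 →L[ℝ] E7)) = phi0 := by
    have h2 : (phi0 ⊙ A) ⊙ (e.symm : E7 →L[ℝ] E7) = (phi0 ⊙ B) ⊙ (e.symm : E7 →L[ℝ] E7) := by
      rw [h]
    refine Eq.trans h2 ?_
    rw [← hB']
    ext v
    simp [Function.comp_def]
  rw [hdet, det_eq_one_of_phi0_comp_eq (fun h0 => hA (by rw [hdet, h0, zero_mul])) h1, one_mul]

/-- On the orthogonal complement of `a`, applying `a × ·` to two of its arguments multiplies `phi0`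
by `-|a|²`. -/
theorem inner_cross_cross_orth {a p q r : E7} (hp : ⟪a, p⟫ = 0) (hq : ⟪a, q⟫ = 0)
    (hr : ⟪a, r⟫ = 0) : ⟪cross (cross a p) (cross a q), r⟫ = -(⟪a, a⟫ * ⟪cross p q, r⟫) := by
  have h := cross_assoc (cross a p) a q
  rw [inner_cross_left, hq, cross_swap (cross a p) a, cross_cross_self, hp] at h
  have h2 : cross (cross a p) (cross a q) =
      (2 * ⟪cross a p, q⟫) • a - cross (-((0 : ℝ) • a - ⟪a, a⟫ • p)) q := by
    rw [eq_sub_iff_add_eq', h]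
    module
  rw [h2, inner_sub_left, inner_smul_left, hr, zero_smul, zero_sub, neg_neg, cross_smul_left,
    inner_smul_left]
  simp

/-- The orthogonal complement of an associative 3-plane is coassociative. -/
theorem inner_cross_eq_zero_of_orth {u v p q r : E7} (hu : u ≠ 0) (hv : v ≠ 0) (huv : ⟪u, v⟫ = 0)
    (hup : ⟪u, p⟫ = 0) (hvp : ⟪v, p⟫ = 0) (hwp : ⟪cross u v, p⟫ = 0)
    (huq : ⟪u, q⟫ = 0) (hvq : ⟪v, q⟫ = 0) (hwq : ⟪cross u v, q⟫ = 0)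
    (hur : ⟪u, r⟫ = 0) (hvr : ⟪v, r⟫ = 0) (hwr : ⟪cross u v, r⟫ = 0) :
    ⟪cross p q, r⟫ = 0 := by
  have key : ∀ x, ⟪u, x⟫ = 0 → ⟪v, x⟫ = 0 →
      cross (cross u v) x = (-1 : ℝ) • cross u (cross v x) := by
    intro x h1 h2
    have h := cross_assoc u v x
    rw [h1, h2, huv] at h
    rw [eq_sub_of_add_eq h]
    module
  have hvx : ∀ x, ⟪cross u v, x⟫ = 0 → ⟪u, cross v x⟫ = 0 := fun x h => by
    rw [real_inner_comm, ← inner_cross_rotate, h]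
  -- Apply the previous identity for `u × v`, and for `u` and `v` in turn.
  have h1 := inner_cross_cross_orth hwp hwq hwr
  rw [key p hup hvp, key q huq hvq, cross_smul_left, cross_smul_right, smul_smul,
    inner_smul_left, inner_cross_cross_orth (hvx p hwp) (hvx q hwq) hur,
    inner_cross_cross_orth hvp hvq hvr, inner_cross_cross, huv] at h1
  simp only [conj_trivial] at h1
  have h2 : ⟪u, u⟫ * ⟪v, v⟫ * ⟪cross p q, r⟫ = 0 := by linarith
  have := inner_self_ne_zero (𝕜 := ℝ).2 hu
  have := inner_self_ne_zero (𝕜 := ℝ).2 hv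
  simp_all

/-- If `phi0` vanishes on `(x, y, z)`, then the associative frame generated by `x × y` and `x × z`
is orthogonal to `x`, `y` and `z`. -/
theorem inner_cross_cross_eq_zero {x y z : E7} (h : ⟪cross x y, z⟫ = 0) :
    (⟪x, cross x y⟫ = 0 ∧ ⟪y, cross x y⟫ = 0 ∧ ⟪z, cross x y⟫ = 0) ∧
    (⟪x, cross x z⟫ = 0 ∧ ⟪y, cross x z⟫ = 0 ∧ ⟪z, cross x z⟫ = 0) ∧
    (⟪x, cross (cross x y) (cross x z)⟫ = 0 ∧ ⟪y, cross (cross x y) (cross x z)⟫ = 0 ∧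
      ⟪z, cross (cross x y) (cross x z)⟫ = 0) := by
  have hswap : ∀ x y z : E7, ⟪cross x y, z⟫ = 0 → ⟪cross x z, y⟫ = 0 := fun x y z h => by
    rw [cross_swap, inner_neg_left, inner_cross_rotate, h, neg_zero]
  have h' : ⟪cross x z, y⟫ = 0 := hswap x y z h
  have key : ∀ t y z : E7, ⟪cross x y, z⟫ = 0 → t = x ∨ t = y →
      ⟪t, cross (cross x y) (cross x z)⟫ = 0 := by
    intro t y z h ht
    rw [real_inner_comm, inner_cross_rotate, inner_cross_rotate]
    rcases ht with rfl | rfl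
    · rw [cross_cross_self, inner_sub_left, inner_smul_left, inner_smul_left,
        real_inner_comm (cross t z) t, inner_cross_left, real_inner_comm (cross t z) y,
        hswap t y z h]
      simp
    · rw [cross_swap x t, ← neg_one_smul ℝ (cross t x), cross_smul_right, cross_cross_self,
        inner_smul_left, inner_sub_left, inner_smul_left, inner_smul_left,
        real_inner_comm (cross x z) x, inner_cross_left, real_inner_comm (cross x z) t,
        hswap x t z h]
      simp
  refine ⟨⟨?_, ?_, ?_⟩, ⟨?_, ?_, ?_⟩, ?_, ?_, ?_⟩
  · rw [real_inner_comm, inner_cross_left]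
  · rw [real_inner_comm, inner_cross_right]
  · rw [real_inner_comm, h]
  · rw [real_inner_comm, inner_cross_left]
  · rw [real_inner_comm, h']
  · rw [real_inner_comm, inner_cross_right]
  · exact key x y z h (Or.inl rfl)
  · exact key y y z h (Or.inr rfl)
  · have := key z z y h' (Or.inr rfl)
    rw [cross_swap, inner_neg_right, this, neg_zero]

/-- If `phi0` vanishes on the image under `N` of an associative plane `V`, then some associative
plane is orthogonal to `N V`. The transpose of `N` maps it into the orthogonal complement of `V`,
where `phi0` vanishes. -/
theorem phi0_comp_ne_zero_of_adjoint {N : E7 →L[ℝ] E7} (hN : N.det ≠ 0)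
    (h : phi0 ⊙ ContinuousLinearMap.adjoint N ∈ tameForms) {u v : E7} (hu : u ≠ 0) (hv : v ≠ 0)
    (huv : ⟪u, v⟫ = 0) : (phi0 ⊙ N) ![u, v, cross u v] ≠ 0 := by
  intro h0
  rw [phi0_comp_apply] at h0
  obtain ⟨⟨h1, h2, h3⟩, ⟨h4, h5, h6⟩, h7, h8, h9⟩ := inner_cross_cross_eq_zero h0
  set a := cross (N u) (N v) with ha
  set b := cross (N u) (N (cross u v)) with hb
  have hinj := (bijective_of_det_ne_zero hN).injective
  have hab : LinearIndependent ℝ ![a, b] := by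
    rw [LinearIndependent.pair_iff]
    intro s t hst
    have hx : s • v + t • cross u v = 0 := by
      by_contra hx
      have h10 : ⟪u, s • v + t • cross u v⟫ = 0 := by
        rw [inner_add_right, inner_smul_right, inner_smul_right, huv, real_inner_comm,
          inner_cross_left]
        simp
      have h11 := (linearIndependent_of_inner_eq_zero hu hx h10).map' (N : E7 →ₗ[ℝ] E7)
        (LinearMap.ker_eq_bot.2 hinj)
      have h12 : (N : E7 →ₗ[ℝ] E7) ∘ ![u, s • v + t • cross u v] =
          ![N u, s • N v + t • N (cross u v)] := by
        funext i; fin_cases i <;> simp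
      rw [h12] at h11
      apply cross_ne_zero h11
      rw [cross_add_right, cross_smul_right, cross_smul_right, hst]
    have hw : cross u v ≠ 0 := cross_ne_zero (linearIndependent_of_inner_eq_zero hu hv huv)
    have h13 : LinearIndependent ℝ ![v, cross u v] :=
      linearIndependent_of_inner_eq_zero hv hw (by rw [real_inner_comm, inner_cross_right])
    exact LinearIndependent.pair_iff.1 h13 s t hx
  have hpos := h a b hab
  rw [phi0_comp_apply] at hpos
  refine hpos.ne' (inner_cross_eq_zero_of_orth hu hv huv ?_ ?_ ?_ ?_ ?_ ?_ ?_ ?_ ?_) <;>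
    rw [ContinuousLinearMap.adjoint_inner_right] <;> assumption

theorem apply_cross_swap (γ : E7 [⋀^Fin 3]→L[ℝ] ℝ) (u v : E7) :
    γ ![v, u, cross v u] = γ ![u, v, cross u v] := by
  have h : γ (![u, v, cross u v] ∘ Equiv.swap (0 : Fin 3) 1) = -γ ![u, v, cross u v] :=
    γ.toAlternatingMap.map_swap ![u, v, cross u v] (i := 0) (j := 1) (by decide)
  have h' : ![u, v, cross u v] ∘ Equiv.swap (0 : Fin 3) 1 = ![v, u, cross u v] := by
    funext i; fin_cases i <;> rfl
  rw [h', ← contr_apply] at h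
  rw [cross_swap v u, ← contr_apply, map_neg, h, neg_neg]

/-- A 3-form without zeros on associative 3-planes has constant sign on them. -/
theorem mem_tameForms_or_neg {γ : E7 [⋀^Fin 3]→L[ℝ] ℝ}
    (h : ∀ u v, LinearIndependent ℝ ![u, v] → γ ![u, v, cross u v] ≠ 0) :
    γ ∈ tameForms ∨ -γ ∈ tameForms := by
  have step : ∀ u v v', LinearIndependent ℝ ![u, v] → LinearIndependent ℝ ![u, v'] →
      0 < γ ![u, v, cross u v] → 0 < γ ![u, v', cross u v'] := by
    intro u v v' hv hv' hpos
    by_contra! hneg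
    have hmem : ∀ x, LinearIndependent ℝ ![u, x] ↔ x ∈ ((ℝ ∙ u : Submodule ℝ E7) : Set E7)ᶜ := by
      intro x
      rw [LinearIndependent.pair_iff' (show u ≠ 0 from hv.ne_zero 0), Set.mem_compl_iff,
        SetLike.mem_coe, Submodule.mem_span_singleton, not_exists]
    have hconn : IsPreconnected ((ℝ ∙ u : Submodule ℝ E7) : Set E7)ᶜ := by
      refine (isConnected_compl_of_one_lt_codim ?_).isPreconnected
      have h1 := (ℝ ∙ u : Submodule ℝ E7).finrank_quotient_add_finrank
      rw [finrank_span_singleton (show u ≠ 0 from hv.ne_zero 0), finrank_euclideanSpace,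
        Fintype.card_fin] at h1
      rw [← Module.finrank_eq_rank]
      exact_mod_cast (by omega : 1 < Module.finrank ℝ (E7 ⧸ (ℝ ∙ u : Submodule ℝ E7)))
    have hcont : Continuous fun x => γ ![u, x, cross u x] := by
      have h1 : Continuous fun x => cross u x :=
        continuous_cross.comp (Continuous.prodMk continuous_const continuous_id)
      have h2 : Continuous fun x => ![u, x, cross u x] := by fun_prop
      exact γ.cont.comp h2
    obtain ⟨x, hx, hx0⟩ := hconn.intermediate_value ((hmem v').1 hv') ((hmem v).1 hv)
      hcont.continuousOn ⟨hneg, hpos.le⟩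
    exact h u x ((hmem x).2 hx) hx0
  by_cases hex : ∃ u v, LinearIndependent ℝ ![u, v] ∧ 0 < γ ![u, v, cross u v]
  · left
    obtain ⟨u, v, huv, hpos⟩ := hex
    intro u' v' huv'
    obtain ⟨x, hx⟩ : ∃ x, x ∉ Submodule.span ℝ {u, u'} := by
      by_contra! hall
      have h1 : Submodule.span ℝ {u, u'} = ⊤ := Submodule.eq_top_iff'.2 hall
      have h2 := finrank_span_le_card (R := ℝ) ({u, u'} : Set E7)
      rw [h1, finrank_top, finrank_euclideanSpace, Fintype.card_fin] at h2
      have h3 : ({u, u'} : Set E7).toFinset.card ≤ 2 := by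
        rw [Set.toFinset_insert, Set.toFinset_singleton]
        exact Finset.card_le_two
      omega
    have hux : LinearIndependent ℝ ![u, x] := by
      rw [LinearIndependent.pair_iff' (show u ≠ 0 from huv.ne_zero 0)]
      rintro a rfl
      exact hx (Submodule.smul_mem _ _ (Submodule.subset_span (by simp)))
    have hu'x : LinearIndependent ℝ ![u', x] := by
      rw [LinearIndependent.pair_iff' (show u' ≠ 0 from huv'.ne_zero 0)]
      rintro a rfl
      exact hx (Submodule.smul_mem _ _ (Submodule.subset_span (by simp)))
    have hxu := LinearIndependent.pair_symm_iff.1 hux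
    have hxu' := LinearIndependent.pair_symm_iff.1 hu'x
    have h1 := step u v x huv hux hpos
    rw [← apply_cross_swap] at h1
    have h2 := step x u u' hxu hxu' h1
    rw [← apply_cross_swap] at h2
    exact step u' x v' hu'x huv' h2
  · right
    push Not at hex
    intro u v huv
    have h1 := lt_of_le_of_ne (hex u v huv) (h u v huv)
    rw [ContinuousAlternatingMap.neg_apply]
    linarith

/-- If `N^* phi0` is tame, then so is the pullback of `phi0` by the transpose of `N`. The tameness
of `N^* phi0` means that `N` carries no associative 3-plane into a coassociative 4-plane, a
condition invariant under transposition. -/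
theorem phi0_comp_adjoint_mem_tameForms {N : E7 →L[ℝ] E7} (hN : 0 < N.det)
    (h : phi0 ⊙ N ∈ tameForms) : phi0 ⊙ ContinuousLinearMap.adjoint N ∈ tameForms := by
  have hdet : (ContinuousLinearMap.adjoint N).det ≠ 0 := by rw [det_adjoint]; exact hN.ne'
  have hne : ∀ u v, LinearIndependent ℝ ![u, v] →
      (phi0 ⊙ ContinuousLinearMap.adjoint N) ![u, v, cross u v] ≠ 0 := by
    intro u v huv
    obtain ⟨w, hw0, huw, hw⟩ := exists_orth_of_linearIndependent huv
    rw [hw]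
    exact phi0_comp_ne_zero_of_adjoint hdet (by rwa [ContinuousLinearMap.adjoint_adjoint])
      (huv.ne_zero 0) hw0 huw
  rcases mem_tameForms_or_neg hne with h1 | h1
  · exact h1
  -- The negative sign would give the transpose of `N` a negative determinant.
  exfalso
  obtain ⟨K, hK, hKN⟩ := tameForms_subset_posOrbit h1
  have h2 : phi0 ⊙ ContinuousLinearMap.adjoint N = phi0 ⊙ ((-1 : ℝ) • K) := by
    rw [phi0_comp_smul, hKN]
    module
  have h3 : ((-1 : ℝ) • K).det = -K.det := by rw [det_smul]; ring
  have h4 := det_eq_of_phi0_comp_eq hdet (by rw [h3]; exact neg_ne_zero.2 hK.ne') h2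
  rw [h3, det_adjoint] at h4
  linarith

/-! ### Associative frames -/

theorem det_gram_eq (w : Fin 3 → E7) : (Matrix.gram ℝ w).det =
    ⟪w 0, w 0⟫ * ⟪w 1, w 1⟫ * ⟪w 2, w 2⟫ - ⟪w 0, w 0⟫ * ⟪w 1, w 2⟫ ^ 2
      - ⟪w 1, w 1⟫ * ⟪w 0, w 2⟫ ^ 2 - ⟪w 2, w 2⟫ * ⟪w 0, w 1⟫ ^ 2
      + 2 * ⟪w 0, w 1⟫ * ⟪w 1, w 2⟫ * ⟪w 0, w 2⟫ := by
  rw [Matrix.det_fin_three]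
  simp only [Matrix.gram_apply]
  rw [real_inner_comm (w 0) (w 1), real_inner_comm (w 0) (w 2), real_inner_comm (w 1) (w 2)]
  ring

theorem vec_eta {V : Type*} (w : Fin 3 → V) : w = ![w 0, w 1, w 2] := by
  funext i; fin_cases i <;> rfl

theorem linearIndependent_cross {u v : E7} (h : LinearIndependent ℝ ![u, v]) :
    LinearIndependent ℝ ![u, v, cross u v] := by
  rw [← Matrix.det_gram_ne_zero_iff_linearIndependent (𝕜 := ℝ), det_gram_eq]
  have h1 := inner_self_ne_zero (𝕜 := ℝ).2 (cross_ne_zero h)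
  have h2 := inner_cross_cross u v
  simp only [Matrix.cons_val]
  rw [real_inner_comm (cross u v) u, real_inner_comm (cross u v) v, inner_cross_left,
    inner_cross_right]
  intro h0
  apply h1
  have : ⟪cross u v, cross u v⟫ * ⟪cross u v, cross u v⟫ = 0 := by
    nth_rw 1 [h2]; linarith
  exact mul_self_eq_zero.1 this

theorem phi0_cross_eq_sqrt (u v : E7) :
    phi0 ![u, v, cross u v] = √(Matrix.gram ℝ ![u, v, cross u v]).det := by
  have h2 := inner_cross_cross u v
  rw [phi0_apply, det_gram_eq]
  simp only [Matrix.cons_val]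
  rw [real_inner_comm (cross u v) u, real_inner_comm (cross u v) v, inner_cross_left,
    inner_cross_right]
  symm
  calc √_ = √(⟪cross u v, cross u v⟫ ^ 2) := by
        congr 1
        linear_combination -⟪cross u v, cross u v⟫ * h2
    _ = _ := Real.sqrt_sq real_inner_self_nonneg

/-- A calibrated frame is, up to a positive factor and up to changes that no 3-form sees, of the
form `(u, v, u × v)`. This is the equality case of the Cauchy-Schwarz inequality. -/
theorem exists_apply_eq_of_phi0_eq_sqrt {w : Fin 3 → E7} (hw : LinearIndependent ℝ w)
    (h : phi0 w = √(Matrix.gram ℝ w).det) : LinearIndependent ℝ ![w 0, w 1] ∧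
      ∃ c : ℝ, 0 < c ∧ ∀ γ : E7 [⋀^Fin 3]→L[ℝ] ℝ, γ w = c * γ ![w 0, w 1, cross (w 0) (w 1)] := by
  have h01 : LinearIndependent ℝ ![w 0, w 1] := by
    have := hw.comp (Fin.castSucc : Fin 2 → Fin 3) (Fin.castSucc_injective 2)
    convert this using 1
    funext i; fin_cases i <;> rfl
  refine ⟨h01, ?_⟩
  set g := phi0 w with hg
  have hgin : g = ⟪cross (w 0) (w 1), w 2⟫ := phi0_apply w
  have hne : (Matrix.gram ℝ w).det ≠ 0 := Matrix.det_gram_ne_zero_iff_linearIndependent.2 hw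
  have hnn : 0 ≤ (Matrix.gram ℝ w).det := (Matrix.posSemidef_gram (𝕜 := ℝ) w).det_nonneg
  have hg0 : 0 < g := by rw [h]; exact Real.sqrt_pos.2 (lt_of_le_of_ne hnn hne.symm)
  have hg2 : g ^ 2 = (Matrix.gram ℝ w).det := by rw [h, Real.sq_sqrt hnn]
  have hcc := real_inner_self_pos.2 (cross_ne_zero h01)
  have hcc2 := inner_cross_cross (w 0) (w 1)
  set x := cross (w 0) (w 1) with hx
  set c := g / ⟪x, x⟫ with hc
  refine ⟨c, by positivity, fun γ => ?_⟩
  have ht : ¬ LinearIndependent ℝ ![w 0, w 1, w 2 - c • x] := by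
    rw [← Matrix.det_gram_ne_zero_iff_linearIndependent (𝕜 := ℝ), not_not, det_gram_eq]
    rw [det_gram_eq] at hg2
    have e0 : ⟪w 0, x⟫ = 0 := by rw [real_inner_comm, hx, inner_cross_left]
    have e1 : ⟪w 1, x⟫ = 0 := by rw [real_inner_comm, hx, inner_cross_right]
    have e2 : ⟪w 2, x⟫ = g := by rw [real_inner_comm, hgin]
    simp only [Matrix.cons_val, inner_sub_left, inner_sub_right, inner_smul_left, inner_smul_right,
      e0, e1, e2, ← hgin, conj_trivial]
    have hcx : c * ⟪x, x⟫ = g := by rw [hc]; field_simp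
    have hcg : c * g * (⟪w 0, w 0⟫ * ⟪w 1, w 1⟫ - ⟪w 0, w 1⟫ ^ 2) = g ^ 2 := by
      rw [← hcc2, mul_right_comm, hcx]; ring
    rw [hcx]
    linear_combination -hcg - hg2
  have h1 : contr γ (w 0) (w 1) (w 2 - c • x) = 0 :=
    γ.toAlternatingMap.map_linearDependent _ ht
  rw [map_sub, map_smul, sub_eq_zero, contr_apply, contr_apply, ← vec_eta] at h1
  exact h1

/-! ### Orientations of frames -/

theorem det_coe_ne_zero (e : E7 ≃L[ℝ] E7) : (e : E7 →L[ℝ] E7).det ≠ 0 :=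
  (LinearEquiv.isUnit_det' e.toLinearEquiv).ne_zero

theorem card_eq_finrank : Fintype.card (Fin 7) = Module.finrank ℝ E7 := by simp

theorem map_trans_orientation {V W U : Type*} [AddCommGroup V] [Module ℝ V] [AddCommGroup W]
    [Module ℝ W] [AddCommGroup U] [Module ℝ U]
    (L : V ≃ₗ[ℝ] W) (e : W ≃ₗ[ℝ] U) (o : Orientation ℝ V (Fin 7)) :
    Orientation.map (Fin 7) (L.trans e) o =
      Orientation.map (Fin 7) e (Orientation.map (Fin 7) L o) := by
  induction o using Module.Ray.ind with
  | h x hx => rfl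

section

variable {V : Type*} [AddCommGroup V] [Module ℝ V] [TopologicalSpace V]

/-- Two frames with the same orientation differ by a map of positive determinant. -/
theorem isOriented_iff {o : Orientation ℝ V (Fin 7)} {L L' : V ≃L[ℝ] E7} (hL : IsOriented o L) :
    IsOriented o L' ↔ 0 < ((L.symm.trans L' : E7 ≃L[ℝ] E7) : E7 →L[ℝ] E7).det := by
  have h := Orientation.map_eq_iff_det_pos stdOrientation (L.symm.trans L').toLinearEquiv
    card_eq_finrank
  refine Iff.trans ?_ h
  rw [IsOriented] at hL ⊢
  rw [← hL, ← map_trans_orientation]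
  have : L.toLinearEquiv.trans (L.symm.trans L').toLinearEquiv = L'.toLinearEquiv := by
    ext x
    simp
  rw [this, hL]

theorem isOriented_or_neg (o : Orientation ℝ V (Fin 7)) (L : V ≃L[ℝ] E7) :
    IsOriented o L ∨ IsOriented o (L.trans (ContinuousLinearEquiv.neg ℝ)) := by
  rcases Orientation.eq_or_eq_neg (Orientation.map (Fin 7) L.toLinearEquiv o) stdOrientation
    card_eq_finrank with h | h
  · exact Or.inl h
  · right
    have hneg : Orientation.map (Fin 7) (LinearEquiv.neg ℝ (M := E7)) stdOrientation =
        -stdOrientation := by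
      rw [Orientation.map_eq_neg_iff_det_neg _ _ card_eq_finrank]
      have h1 := det_smul (-1) (ContinuousLinearMap.id ℝ E7)
      rw [det_id] at h1
      have h2 : (LinearEquiv.neg ℝ (M := E7) : E7 →ₗ[ℝ] E7) =
          (((-1 : ℝ) • ContinuousLinearMap.id ℝ E7 : E7 →L[ℝ] E7) : E7 →ₗ[ℝ] E7) := by
        ext x
        simp
      rw [h2]
      change ((-1 : ℝ) • ContinuousLinearMap.id ℝ E7).det < 0
      rw [h1]
      norm_num
    have h3 := map_trans_orientation L.toLinearEquiv (LinearEquiv.neg ℝ (M := E7)) o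
    rw [h, Orientation.map_neg, hneg] at h3
    exact h3.trans (neg_neg stdOrientation)

/-- A positive 4-form on an oriented space has oriented frames, as `-1` reverses the orientation
and preserves 4-forms. -/
theorem orientedFrames4_nonempty (o : Orientation ℝ V (Fin 7)) {β : V [⋀^Fin 4]→L[ℝ] ℝ}
    (h : (frames4 β).Nonempty) : (orientedFrames4 o β).Nonempty := by
  obtain ⟨L, hL⟩ := h
  rcases isOriented_or_neg o L with ho | ho
  · exact ⟨L, ho, hL⟩
  · refine ⟨_, ho, ?_⟩
    change starPhi0 ⊙ (L : V →L[ℝ] E7) = β at hL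
    change starPhi0 ⊙ ((L.trans (ContinuousLinearEquiv.neg ℝ) : V ≃L[ℝ] E7) : V →L[ℝ] E7) = β
    rw [← hL]
    ext v
    rw [ContinuousAlternatingMap.compContinuousLinearMap_apply,
      ContinuousAlternatingMap.compContinuousLinearMap_apply]
    have h1 := starPhi0.toMultilinearMap.map_smul_univ (fun _ => (-1 : ℝ)) (L ∘ v)
    simp only [Finset.prod_const, Finset.card_univ, Fintype.card_fin] at h1
    norm_num at h1
    simpa [Function.comp_def] using h1

end

/-! ### Tamed pairs of forms on a vector space -/

/-- If `star b = phi0 ⊙ M`, then `normalizer M` is the linear map that pulls `b` back to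
`starPhi0`: the adjoint of `M`, with the scalar factor that the weights of `star` require. -/
def normalizer (M : E7 →L[ℝ] E7) : E7 →L[ℝ] E7 := (√√M.det)⁻¹ • ContinuousLinearMap.adjoint M

theorem normalizer_id : normalizer (ContinuousLinearMap.id ℝ E7) = ContinuousLinearMap.id ℝ E7 := by
  have h : ContinuousLinearMap.adjoint (ContinuousLinearMap.id ℝ E7) =
      ContinuousLinearMap.id ℝ E7 := by
    ext1 x
    refine ext_inner_left ℝ fun y => ?_
    rw [ContinuousLinearMap.adjoint_inner_right]
    rfl
  rw [normalizer, det_id, h]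
  simp

theorem det_normalizer (M : E7 →L[ℝ] E7) (hM : 0 < M.det) :
    (normalizer M).det = (√√M.det)⁻¹ ^ 3 := by
  rw [normalizer, det_smul, det_adjoint]
  have h4 : M.det = √√M.det ^ 4 := by
    rw [show (4 : ℕ) = 2 * 2 from rfl, pow_mul, Real.sq_sqrt (Real.sqrt_nonneg _),
      Real.sq_sqrt hM.le]
  have hc : 0 < √√M.det := by positivity
  nth_rw 2 [h4]
  field_simp

theorem det_normalizer_pos {M : E7 →L[ℝ] E7} (hM : 0 < M.det) : 0 < (normalizer M).det := by
  rw [det_normalizer M hM]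
  positivity

theorem continuousAt_normalizer :
    ContinuousAt normalizer (ContinuousLinearMap.id ℝ E7) := by
  have h1 : ContinuousAt (fun M : E7 →L[ℝ] E7 => (√√M.det)⁻¹)
      (ContinuousLinearMap.id ℝ E7) := by
    refine ContinuousAt.inv₀ ?_ (by rw [det_id]; simp)
    exact (ContinuousLinearMap.continuous_det.sqrt.sqrt).continuousAt
  exact h1.smul (ContinuousLinearMap.adjoint (𝕜 := ℝ) (E := E7) (F := E7)).continuous.continuousAt

theorem comp_assoc {U V W : Type*} [AddCommGroup U] [Module ℝ U] [TopologicalSpace U]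
    [AddCommGroup V] [Module ℝ V] [TopologicalSpace V]
    [AddCommGroup W] [Module ℝ W] [TopologicalSpace W] {k : ℕ} (θ : W [⋀^Fin k]→L[ℝ] ℝ)
    (A : V →L[ℝ] W) (B : U →L[ℝ] V) : θ ⊙ A ⊙ B = θ ⊙ (A ∘L B) := rfl

theorem comp_injective {A : E7 →L[ℝ] E7} (hA : A.det ≠ 0) {k : ℕ} :
    Function.Injective fun θ : E7 [⋀^Fin k]→L[ℝ] ℝ => θ ⊙ A := by
  intro θ η h
  ext v
  obtain ⟨w, rfl⟩ : ∃ w : Fin k → E7, v = A ∘ w :=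
    ⟨fun i => (equivOfDet A hA).symm (v i), funext fun i =>
      ((equivOfDet A hA).apply_symm_apply (v i)).symm⟩
  exact congrArg (fun ζ : E7 [⋀^Fin k]→L[ℝ] ℝ => ζ w) h

/-- The scalar in `normalizer` is the fourth root of `(det M)⁻¹`, as it has to satisfy
`c ^ 3 = det (c • Mᵀ) = c ^ 7 * det M`; see `star_comp`. -/
theorem comp_normalizer {b : E7 [⋀^Fin 4]→L[ℝ] ℝ} {M : E7 →L[ℝ] E7} (hM : 0 < M.det)
    (h : star b = phi0 ⊙ M) : b ⊙ normalizer M = starPhi0 := by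
  apply star_injective
  rw [star_starPhi0]
  have hN : ContinuousLinearMap.adjoint (normalizer M) = (√√M.det)⁻¹ • M := by
    rw [normalizer, map_smulₛₗ, ContinuousLinearMap.adjoint_adjoint]
    rfl
  have h1 := star_comp b (normalizer M)
  rw [det_normalizer M hM, h, ← phi0_comp_smul, ← hN] at h1
  refine comp_injective ?_ h1
  rw [det_adjoint]
  exact (det_normalizer_pos hM).ne'

instance finiteDimensional_form (k : ℕ) : FiniteDimensional ℝ (E7 [⋀^Fin k]→L[ℝ] ℝ) :=
  FiniteDimensional.of_injective
    (V₂ := (Fin k → Fin 7) → ℝ)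
    { toFun := fun θ s => θ fun i => stdB (s i)
      map_add' := fun _ _ => rfl
      map_smul' := fun _ _ => rfl }
    fun _ _ h => ext_stdB fun s => congrFun h s

theorem continuous_star : Continuous star :=
  LinearMap.continuous_of_finiteDimensional star

section

variable {V : Type*} [AddCommGroup V] [Module ℝ V] [TopologicalSpace V]
  {o : Orientation ℝ V (Fin 7)} {α α' : V [⋀^Fin 3]→L[ℝ] ℝ} {β β' : V [⋀^Fin 4]→L[ℝ] ℝ}

/-- The pointwise conditions on a tamed almost-`G₂`-manifold: `α` and `β` are positive, `α` induces
the orientation `o`, and `α` is positive on the associative 3-planes of `β`. -/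
structure IsTamedPair (o : Orientation ℝ V (Fin 7)) (α : V [⋀^Fin 3]→L[ℝ] ℝ)
    (β : V [⋀^Fin 4]→L[ℝ] ℝ) : Prop where
  positive3 : (frames3 α).Nonempty
  positive4 : (frames4 β).Nonempty
  induced : ∀ L ∈ frames3 α, IsOriented o L
  tamed : ∀ v, IsAssociative (orientedFrames4 o β) v → 0 < α v

theorem mem_frames3 {L : V ≃L[ℝ] E7} : L ∈ frames3 α ↔ phi0 ⊙ (L : V →L[ℝ] E7) = α := Iff.rfl

theorem mem_frames4 {L : V ≃L[ℝ] E7} : L ∈ frames4 β ↔ starPhi0 ⊙ (L : V →L[ℝ] E7) = β := Iff.rfl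

theorem comp_symm_self (L : V ≃L[ℝ] E7) {k : ℕ} (θ : E7 [⋀^Fin k]→L[ℝ] ℝ) :
    θ ⊙ (L : V →L[ℝ] E7) ⊙ (L.symm : E7 →L[ℝ] V) = θ := by
  ext v
  simp [Function.comp_def]

theorem comp_self_symm (L : V ≃L[ℝ] E7) {k : ℕ} (θ : V [⋀^Fin k]→L[ℝ] ℝ) :
    θ ⊙ (L.symm : E7 →L[ℝ] V) ⊙ (L : V →L[ℝ] E7) = θ := by
  ext v
  simp [Function.comp_def]

/-- In a frame adapted to `β`, the pair `(α, β)` is tamed iff `α` is a tame form. The positivity of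
`α` and the orientation come from `tameForms_subset_posOrbit`. -/
theorem isTamedPair_iff_of_mem_orientedFrames4 {L : V ≃L[ℝ] E7} (hL : L ∈ orientedFrames4 o β) :
    IsTamedPair o α β ↔ α ⊙ (L.symm : E7 →L[ℝ] V) ∈ tameForms := by
  constructor
  · intro h u v huv
    refine h.tamed (fun i => L.symm (![u, v, cross u v] i)) ⟨?_, L, hL, ?_⟩
    · exact (linearIndependent_cross huv).map' (L.symm.toLinearEquiv : E7 →ₗ[ℝ] V)
        (LinearEquiv.ker _)
    · simp only [ContinuousLinearEquiv.apply_symm_apply]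
      exact phi0_cross_eq_sqrt u v
  · intro h
    obtain ⟨M, hM, hMa⟩ := tameForms_subset_posOrbit h
    refine ⟨⟨L.trans (equivOfDet M hM.ne'), ?_⟩, ⟨L, hL.2⟩, fun K hK => ?_, ?_⟩
    · rw [mem_frames3, ← comp_self_symm L α, ← hMa, comp_assoc]
      congr 1
    · rw [isOriented_iff hL.1]
      rw [mem_frames3] at hK
      rw [det_eq_of_phi0_comp_eq (det_coe_ne_zero _) hM.ne']
      · exact hM
      · rw [hMa, ← hK]
        rfl
    · rintro v ⟨hv, L', hL', h1⟩
      have hN := (isOriented_iff hL.1).1 hL'.1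
      have hNs : starPhi0 ⊙ ((L.symm.trans L' : E7 ≃L[ℝ] E7) : E7 →L[ℝ] E7) = starPhi0 := by
        have h2 := mem_frames4.1 hL'.2
        have h3 := mem_frames4.1 hL.2
        conv_rhs => rw [← comp_symm_self L starPhi0, h3, ← h2]
        rfl
      have hN3 := phi0_comp_eq_of_starPhi0_comp_eq hN hNs
      have hin := inner_of_phi0_comp_eq hN.ne' hN3
      set N : E7 →L[ℝ] E7 := ((L.symm.trans L' : E7 ≃L[ℝ] E7) : E7 →L[ℝ] E7) with hNdef
      set w : Fin 3 → E7 := fun i => L (v i) with hw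
      have hL'v : ∀ i, L' (v i) = N (w i) := fun i => by simp [hNdef, hw]
      simp only [hL'v] at h1
      have hw_ind : LinearIndependent ℝ w :=
        hv.map' (L.toLinearEquiv : V →ₗ[ℝ] E7) (LinearEquiv.ker _)
      have h2 : phi0 w = √(Matrix.gram ℝ w).det := by
        have h3 : phi0 w = phi0 (fun i => N (w i)) := by
          conv_lhs => rw [← hN3]
          rfl
        rw [h3, h1]
        congr 2
        ext i j
        simp only [Matrix.gram_apply, hin]
      obtain ⟨h01, c, hc, hcw⟩ := exists_apply_eq_of_phi0_eq_sqrt hw_ind h2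
      have h4 : α v = (α ⊙ (L.symm : E7 →L[ℝ] V)) w := by
        simp [hw, Function.comp_def]
      rw [h4, hcw]
      exact mul_pos hc (h _ _ h01)

/-- How to find a frame adapted to `β` from one that represents `star` of `β`. -/
theorem trans_normalizer_mem_orientedFrames4 {K : V ≃L[ℝ] E7} (hK : IsOriented o K)
    {M : E7 →L[ℝ] E7} (hM : 0 < M.det) (h : star (β ⊙ (K.symm : E7 →L[ℝ] V)) = phi0 ⊙ M) :
    K.trans (equivOfDet (normalizer M) (det_normalizer_pos hM).ne').symm ∈
      orientedFrames4 o β := by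
  set e := equivOfDet (normalizer M) (det_normalizer_pos hM).ne' with he
  have he' : (e : E7 →L[ℝ] E7) = normalizer M := coe_equivOfDet _ _
  constructor
  · rw [isOriented_iff hK]
    have h1 : ((e.symm : E7 ≃L[ℝ] E7) : E7 →L[ℝ] E7).det * (e : E7 →L[ℝ] E7).det = 1 := by
      rw [← det_comp, ContinuousLinearEquiv.coe_symm_comp_coe, det_id]
    rw [he'] at h1
    have h2 : K.symm.trans (K.trans e.symm) = e.symm := by
      ext x
      simp
    rw [h2]
    exact pos_of_mul_pos_left (by rw [h1]; exact one_pos) (det_normalizer_pos hM).le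
  · rw [mem_frames4, ← comp_normalizer hM h, ← he']
    ext v
    simp [Function.comp_def]

theorem comp_symm_trans_symm {K : V ≃L[ℝ] E7} {N : E7 →L[ℝ] E7} (hN : N.det ≠ 0) :
    α ⊙ ((K.trans (equivOfDet N hN).symm).symm : E7 →L[ℝ] V) =
      α ⊙ (K.symm : E7 →L[ℝ] V) ⊙ N := by
  conv_rhs => rw [← coe_equivOfDet N hN]
  rfl

/-- In a frame adapted to `α`, the pair `(α, β)` is tamed iff `star` of `β` is a tame form. -/
theorem isTamedPair_iff_of_mem_frames3 {K : V ≃L[ℝ] E7} (hK : K ∈ frames3 α)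
    (hoK : IsOriented o K) :
    IsTamedPair o α β ↔ star (β ⊙ (K.symm : E7 →L[ℝ] V)) ∈ tameForms := by
  rw [mem_frames3] at hK
  constructor
  · intro h
    obtain ⟨L, hL⟩ := orientedFrames4_nonempty o h.positive4
    have h1 := (isTamedPair_iff_of_mem_orientedFrames4 hL).1 h
    have hN := (isOriented_iff hL.1).1 hoK
    set N : E7 →L[ℝ] E7 := ((L.symm.trans K : E7 ≃L[ℝ] E7) : E7 →L[ℝ] E7) with hNdef
    have h2 : phi0 ⊙ N = α ⊙ (L.symm : E7 →L[ℝ] V) := by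
      rw [← hK]
      rfl
    have h3 : β ⊙ (K.symm : E7 →L[ℝ] V) ⊙ N = starPhi0 := by
      rw [← comp_symm_self L starPhi0, mem_frames4.1 hL.2]
      ext v
      simp [hNdef, Function.comp_def]
    have h4 := star_comp (β ⊙ (K.symm : E7 →L[ℝ] V)) N
    rw [h3, star_starPhi0] at h4
    rw [← h2] at h1
    have h5 := smul_mem_tameForms (phi0_comp_adjoint_mem_tameForms hN h1) (inv_pos.2 hN)
    rwa [h4, inv_smul_smul₀ hN.ne'] at h5
  · intro h
    obtain ⟨M, hM, hMb⟩ := tameForms_subset_posOrbit h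
    have hL := trans_normalizer_mem_orientedFrames4 hoK hM hMb.symm
    rw [isTamedPair_iff_of_mem_orientedFrames4 hL, comp_symm_trans_symm, ← hK, comp_symm_self,
      normalizer, phi0_comp_smul]
    rw [← hMb] at h
    exact smul_mem_tameForms (phi0_comp_adjoint_mem_tameForms hM h) (by positivity)

theorem IsTamedPair.add_left (h : IsTamedPair o α β) (h' : IsTamedPair o α' β) :
    IsTamedPair o (α + α') β := by
  obtain ⟨L, hL⟩ := orientedFrames4_nonempty o h.positive4
  rw [isTamedPair_iff_of_mem_orientedFrames4 hL] at h h' ⊢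
  exact add_mem_tameForms h h'

theorem IsTamedPair.smul_left (h : IsTamedPair o α β) {c : ℝ} (hc : 0 < c) :
    IsTamedPair o (c • α) β := by
  obtain ⟨L, hL⟩ := orientedFrames4_nonempty o h.positive4
  rw [isTamedPair_iff_of_mem_orientedFrames4 hL] at h ⊢
  exact smul_mem_tameForms h hc

theorem IsTamedPair.add_right (h : IsTamedPair o α β) (h' : IsTamedPair o α β') :
    IsTamedPair o α (β + β') := by
  obtain ⟨K, hK⟩ := h.positive3
  have hoK := h.induced K hK
  rw [isTamedPair_iff_of_mem_frames3 hK hoK] at h h' ⊢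
  have := add_mem_tameForms h h'
  rwa [← map_add] at this

theorem IsTamedPair.smul_right (h : IsTamedPair o α β) {c : ℝ} (hc : 0 < c) :
    IsTamedPair o α (c • β) := by
  obtain ⟨K, hK⟩ := h.positive3
  have hoK := h.induced K hK
  rw [isTamedPair_iff_of_mem_frames3 hK hoK] at h ⊢
  have := smul_mem_tameForms h hc
  rwa [← map_smul] at this

theorem isOriented_map {W : Type*} [AddCommGroup W] [Module ℝ W] [TopologicalSpace W]
    (T : V ≃L[ℝ] W) (K : W ≃L[ℝ] E7) :
    IsOriented (Orientation.map (Fin 7) T.toLinearEquiv o) K ↔ IsOriented o (T.trans K) := by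
  rw [IsOriented, ← map_trans_orientation]
  rfl

theorem IsTamedPair.map {W : Type*} [AddCommGroup W] [Module ℝ W] [TopologicalSpace W]
    (T : V ≃L[ℝ] W) (h : IsTamedPair o α β) :
    IsTamedPair (Orientation.map (Fin 7) T.toLinearEquiv o) (α ⊙ (T.symm : W →L[ℝ] V))
      (β ⊙ (T.symm : W →L[ℝ] V)) where
  positive3 := by
    obtain ⟨L, hL⟩ := h.positive3
    refine ⟨T.symm.trans L, ?_⟩
    rw [mem_frames3, ← mem_frames3.1 hL]
    rfl
  positive4 := by
    obtain ⟨L, hL⟩ := h.positive4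
    refine ⟨T.symm.trans L, ?_⟩
    rw [mem_frames4, ← mem_frames4.1 hL]
    rfl
  induced K hK := by
    rw [isOriented_map]
    refine h.induced _ ?_
    rw [mem_frames3] at hK ⊢
    ext v
    have := congrArg (fun ζ : W [⋀^Fin 3]→L[ℝ] ℝ => ζ (T ∘ v)) hK
    simpa [Function.comp_def] using this
  tamed v := by
    rintro ⟨hv, L, hL, h1⟩
    refine h.tamed (fun i => T.symm (v i)) ⟨?_, T.trans L, ⟨?_, ?_⟩, ?_⟩
    · exact hv.map' (T.symm.toLinearEquiv : W →ₗ[ℝ] V) (LinearEquiv.ker _)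
    · exact (isOriented_map T L).1 hL.1
    · have hL2 := hL.2
      rw [mem_frames4] at hL2 ⊢
      ext v
      have := congrArg (fun ζ : W [⋀^Fin 4]→L[ℝ] ℝ => ζ (T ∘ v)) hL2
      simpa [Function.comp_def] using this
    · simpa using h1

theorem isTamedPair_map_iff {W : Type*} [AddCommGroup W] [Module ℝ W] [TopologicalSpace W]
    (T : V ≃L[ℝ] W) : IsTamedPair (Orientation.map (Fin 7) T.toLinearEquiv o)
      (α ⊙ (T.symm : W →L[ℝ] V)) (β ⊙ (T.symm : W →L[ℝ] V)) ↔ IsTamedPair o α β := by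
  refine ⟨fun h => ?_, fun h => h.map T⟩
  have h1 := h.map T.symm
  rw [← map_trans_orientation] at h1
  convert h1 using 1
  · have : T.toLinearEquiv.trans T.symm.toLinearEquiv = LinearEquiv.refl ℝ V := by
      ext x
      simp
    rw [this]
    exact (congrFun (congrArg DFunLike.coe (Orientation.map_refl (R := ℝ) (M := V) (Fin 7))) o).symm
  · ext v
    simp [Function.comp_def]
  · ext v
    simp [Function.comp_def]

end

/-- Tamedness is an open condition on pairs of forms. -/
theorem isOpen_isTamedPair (o : Orientation ℝ E7 (Fin 7)) :
    IsOpen {p : (E7 [⋀^Fin 3]→L[ℝ] ℝ) × (E7 [⋀^Fin 4]→L[ℝ] ℝ) | IsTamedPair o p.1 p.2} := by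
  rw [isOpen_iff_mem_nhds]
  rintro ⟨α, β⟩ h
  obtain ⟨L, hL⟩ := orientedFrames4_nonempty o h.positive4
  have hα := (isTamedPair_iff_of_mem_orientedFrames4 hL).1 h
  have hev : ∀ᶠ q : (E7 →L[ℝ] E7) × (E7 [⋀^Fin 3]→L[ℝ] ℝ) in
      𝓝 (ContinuousLinearMap.id ℝ E7) ×ˢ 𝓝 α, 0 < q.1.det ∧
        q.2 ⊙ (L.symm : E7 →L[ℝ] E7) ⊙ normalizer q.1 ∈ tameForms := by
    rw [← nhds_prod_eq]
    have hdet : ContinuousAt (fun q : (E7 →L[ℝ] E7) × (E7 [⋀^Fin 3]→L[ℝ] ℝ) => q.1.det)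
        (ContinuousLinearMap.id ℝ E7, α) :=
      (ContinuousLinearMap.continuous_det.comp continuous_fst).continuousAt
    have hpull : ContinuousAt (fun q : (E7 →L[ℝ] E7) × (E7 [⋀^Fin 3]→L[ℝ] ℝ) =>
        q.2 ⊙ (L.symm : E7 →L[ℝ] E7) ⊙ normalizer q.1) (ContinuousLinearMap.id ℝ E7, α) := by
      have hcomp : Continuous fun r : (E7 [⋀^Fin 3]→L[ℝ] ℝ) × (E7 →L[ℝ] E7) =>
          r.1 ⊙ (L.symm : E7 →L[ℝ] E7) ⊙ r.2 :=
        continuous_comp.comp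
          (((continuous_comp_left (L.symm : E7 →L[ℝ] E7)).comp continuous_fst).prodMk
            continuous_snd)
      exact hcomp.continuousAt.comp (continuousAt_snd.prodMk
        (ContinuousAt.comp (f := Prod.fst) (g := normalizer) continuousAt_normalizer
          continuousAt_fst))
    refine (hdet.eventually (lt_mem_nhds ?_)).and
      (hpull.eventually (isOpen_tameForms.mem_nhds ?_))
    · change 0 < (ContinuousLinearMap.id ℝ E7).det
      rw [det_id]
      exact one_pos
    · change α ⊙ (L.symm : E7 →L[ℝ] E7) ⊙ normalizer (ContinuousLinearMap.id ℝ E7) ∈ tameForms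
      rw [normalizer_id]
      exact hα
  obtain ⟨P, hP, Q, hQ, hPQ⟩ := Filter.eventually_prod_iff.1 hev
  have hβ : ∀ᶠ β' in 𝓝 β, ∃ M, P M ∧
      star (β' ⊙ (L.symm : E7 →L[ℝ] E7)) = phi0 ⊙ M := by
    have hc : ContinuousAt (fun β' : E7 [⋀^Fin 4]→L[ℝ] ℝ => star (β' ⊙ (L.symm : E7 →L[ℝ] E7))) β :=
      (continuous_star.comp (continuous_comp_left _)).continuousAt
    have h0 : star (β ⊙ (L.symm : E7 →L[ℝ] E7)) = phi0 := by
      have h1 : starPhi0 ⊙ (L : E7 →L[ℝ] E7) = β := hL.2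
      rw [← h1, comp_symm_self, star_starPhi0]
    have h1 := image_phi0_comp_mem_nhds_id hP
    rw [ContinuousAt, h0] at hc
    filter_upwards [hc h1] with β' hβ'
    obtain ⟨M, hM, hMb⟩ := hβ'
    exact ⟨M, hM, hMb.symm⟩
  rw [nhds_prod_eq]
  filter_upwards [hQ.prod_mk hβ] with p hp
  obtain ⟨hp1, M, hM, hMb⟩ := hp
  obtain ⟨hdet, htame⟩ := hPQ hM hp1
  rw [isTamedPair_iff_of_mem_orientedFrames4 (trans_normalizer_mem_orientedFrames4 hL.1 hdet hMb),
    comp_symm_trans_symm]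
  exact htame

/-! ### The topology on forms and on cohomology -/

section

variable {X : Type*} [TopologicalSpace X] [ChartedSpace E7 X]

theorem DiffForm.contDiffAt_rep {k : ℕ} (θ : DiffForm X k) (x₀ : X) {y : E7}
    (hy : y ∈ (chartAt E7 x₀).target) : ContDiffAt ℝ ∞ (θ.rep x₀) y :=
  (θ.2 x₀).contDiffAt ((chartAt E7 x₀).open_target.mem_nhds hy)

/-- The derivatives of order `j` of the coefficients in the chart at `x₀`, on the chart target. -/
def derivRep (X : Type*) [TopologicalSpace X] [ChartedSpace E7 X] (k : ℕ) (x₀ : X) (j : ℕ) :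
    DiffForm X k →ₗ[ℝ]
      ((chartAt E7 x₀).target → E7 [×j]→L[ℝ] (E7 [⋀^Fin k]→L[ℝ] ℝ)) where
  toFun θ y := iteratedFDeriv ℝ j (θ.rep x₀) y
  map_add' θ η := by
    funext y
    exact iteratedFDeriv_add_apply ((θ.contDiffAt_rep x₀ y.2).of_le (by exact_mod_cast le_top))
      ((η.contDiffAt_rep x₀ y.2).of_le (by exact_mod_cast le_top))
  map_smul' c θ := by
    funext y
    exact iteratedFDeriv_const_smul_apply (𝕜 := ℝ) (a := c)
      ((θ.contDiffAt_rep x₀ y.2).of_le (by exact_mod_cast le_top))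

theorem continuous_derivRep {k : ℕ} (x₀ : X) (j : ℕ) (θ : DiffForm X k) :
    Continuous (derivRep X k x₀ j θ) := by
  have h1 := (θ.2 x₀).continuousOn_iteratedFDerivWithin (m := j) (by exact_mod_cast le_top)
    (chartAt E7 x₀).open_target.uniqueDiffOn
  have h2 : ContinuousOn (iteratedFDeriv ℝ j (θ.rep x₀)) (chartAt E7 x₀).target :=
    h1.congr fun y hy => (iteratedFDerivWithin_of_isOpen j (chartAt E7 x₀).open_target hy).symm
  exact continuousOn_iff_continuous_domRestrict.1 h2

instance (k : ℕ) : IsTopologicalAddGroup (DiffForm X k) := by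
  refine topologicalAddGroup_iInf fun x₀ => topologicalAddGroup_iInf fun j => ?_
  let f : DiffForm X k →+ UniformOnFun (chartAt E7 x₀).target
      (E7 [×j]→L[ℝ] (E7 [⋀^Fin k]→L[ℝ] ℝ)) {K | IsCompact K} :=
    { toFun := UniformOnFun.ofFun {K | IsCompact K} ∘ derivRep X k x₀ j
      map_zero' := congrArg (UniformOnFun.ofFun _) (map_zero (derivRep X k x₀ j))
      map_add' := fun θ η => congrArg (UniformOnFun.ofFun _) (map_add (derivRep X k x₀ j) θ η) }
  exact topologicalAddGroup_induced f

instance (k : ℕ) : ContinuousSMul ℝ (DiffForm X k) := by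
  refine continuousSMul_iInf fun x₀ => continuousSMul_iInf fun j => ?_
  let _ : TopologicalSpace (DiffForm X k) := TopologicalSpace.induced
      (UniformOnFun.ofFun {K : Set (chartAt E7 x₀).target | IsCompact K} ∘ derivRep X k x₀ j)
      inferInstance
  refine UniformOnFun.continuousSMul_induced_of_image_bounded ℝ _ _ _ (derivRep X k x₀ j)
    (𝔖 := {K | IsCompact K}) ⟨rfl⟩ fun θ K hK => ?_
  exact (hK.image (continuous_derivRep x₀ j θ)).isVonNBounded ℝ

/-- Forms that are close in the `C^∞` topology have uniformly close coefficients on a compact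
subset of a chart. -/
theorem DiffForm.eventually_dist_rep_lt {k : ℕ} (θ : DiffForm X k) (x₀ : X) {K : Set E7}
    (hK : IsCompact K) (hKt : K ⊆ (chartAt E7 x₀).target) {δ : ℝ} (hδ : 0 < δ) :
    ∀ᶠ η in 𝓝 θ, ∀ y ∈ K, dist (η.rep x₀ y) (θ.rep x₀ y) < δ := by
  have hc : Continuous (UniformOnFun.ofFun {K : Set (chartAt E7 x₀).target | IsCompact K} ∘
      derivRep X k x₀ 0) := by
    rw [continuous_iff_le_induced]
    exact (iInf_le _ x₀).trans (iInf_le _ 0)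
  have hK' : IsCompact ((↑) ⁻¹' K : Set (chartAt E7 x₀).target) := by
    rw [Subtype.isCompact_iff, Subtype.image_preimage_coe, Set.inter_eq_right.2 hKt]
    exact hK
  have hV : {p : (E7 [×0]→L[ℝ] (E7 [⋀^Fin k]→L[ℝ] ℝ)) × (E7 [×0]→L[ℝ] (E7 [⋀^Fin k]→L[ℝ] ℝ)) |
      dist p.1 p.2 < δ} ∈ uniformity (E7 [×0]→L[ℝ] (E7 [⋀^Fin k]→L[ℝ] ℝ)) :=
    Metric.dist_mem_uniformity (α := E7 [×0]→L[ℝ] (E7 [⋀^Fin k]→L[ℝ] ℝ)) hδ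
  have h := (hc.continuousAt (x := θ)).eventually
    (UniformOnFun.gen_mem_nhds _ {K : Set (chartAt E7 x₀).target | IsCompact K} _ hK' hV)
  filter_upwards [h] with η hη y hy
  have h1 : dist (iteratedFDeriv ℝ 0 (θ.rep x₀) y) (iteratedFDeriv ℝ 0 (η.rep x₀) y) < δ :=
    hη ⟨y, hKt hy⟩ hy
  rw [iteratedFDeriv_zero_eq_comp, iteratedFDeriv_zero_eq_comp, Function.comp_apply,
    Function.comp_apply, LinearIsometryEquiv.dist_map] at h1
  rwa [dist_comm]

end

/-- Open convex cones stay open convex cones in a quotient, where open can be understood in the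
module topology, as this is finer than the quotient topology. -/
theorem image_mk_of_isOpen_of_isConvexCone {M : Type*} [AddCommGroup M] [Module ℝ M]
    [TopologicalSpace M] [IsTopologicalAddGroup M] [ContinuousSMul ℝ M] (N : Submodule ℝ M)
    {C : Set M} (hC : IsOpen C) (hconv : IsConvexCone C) :
    IsOpen ((Submodule.Quotient.mk : M → M ⧸ N) '' C) ∧
      IsOpen[moduleTopology ℝ (M ⧸ N)] ((Submodule.Quotient.mk : M → M ⧸ N) '' C) ∧
      IsConvexCone ((Submodule.Quotient.mk : M → M ⧸ N) '' C) := by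
  have h1 : IsOpen ((Submodule.Quotient.mk : M → M ⧸ N) '' C) := N.isOpenMap_mkQ C hC
  refine ⟨h1, moduleTopology_le ℝ (M ⧸ N) _ h1, ?_⟩
  obtain ⟨D, rfl⟩ := hconv
  exact ⟨D.map N.mkQ, rfl⟩

/-! ### Tamed pairs on a compact manifold -/

section

variable {X : Type*} [TopologicalSpace X] [ChartedSpace E7 X] [IsManifold (𝓡 7) ∞ X]
  {o : ManifoldOrientation X} {φ : DiffForm X 3} {ψ : DiffForm X 4}

theorem isOrientedTAG2_iff : IsOrientedTAG2 o φ ψ ↔ φ ∈ closedForms X 3 ∧ ψ ∈ closedForms X 4 ∧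
    ∀ x, IsTamedPair (o.orientAt x) (φ.valAt x) (ψ.valAt x) :=
  ⟨fun h => ⟨h.closed_phi, h.closed_psi, fun x =>
    ⟨h.positive_phi x, h.positive_psi x, h.induced x, h.tamed x⟩⟩,
  fun ⟨h3, h4, h⟩ => ⟨h3, fun x => (h x).positive3, h4, fun x => (h x).positive4,
    fun x => (h x).induced, fun x => (h x).tamed⟩⟩

/-- Tamedness can be checked on coefficients in a chart, which are transported by its derivative. -/
theorem isTamedPair_rep_iff (x₀ : X) {y : E7} (hy : y ∈ (chartAt E7 x₀).target) :
    IsTamedPair (orientInChart x₀ ⟨(chartAt E7 x₀).symm y, (chartAt E7 x₀).map_target hy⟩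
        (o.orientAt ((chartAt E7 x₀).symm y))) (φ.rep x₀ y) (ψ.rep x₀ y) ↔
      IsTamedPair (o.orientAt ((chartAt E7 x₀).symm y)) (φ.valAt ((chartAt E7 x₀).symm y))
        (ψ.valAt ((chartAt E7 x₀).symm y)) := by
  have : IsManifold (𝓡 7) 1 X := IsManifold.of_le (n := ∞) (by exact_mod_cast le_top)
  let T : TangentSpace (𝓡 7) ((chartAt E7 x₀).symm y) ≃L[ℝ] E7 :=
    (mdifferentiable_chart (I := 𝓡 7) x₀).mfderiv ((chartAt E7 x₀).map_target hy)
  -- The tangent spaces involved are all copies of `E7`, which is how the types match.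
  let G : E7 → E7 →L[ℝ] E7 := fun z =>
    mfderiv (𝓡 7) (𝓡 7) ((chartAt E7 x₀).symm : E7 → X) z
  have key : ∀ {k : ℕ} (θ : E7 [⋀^Fin k]→L[ℝ] ℝ),
      θ ⊙ G y = θ ⊙ G (chartAt E7 x₀ ((chartAt E7 x₀).symm y)) := fun θ => by
    rw [(chartAt E7 x₀).right_inv hy]
  have h3 : φ.rep x₀ y = φ.valAt ((chartAt E7 x₀).symm y) ⊙
      (T.symm : E7 →L[ℝ] TangentSpace (𝓡 7) ((chartAt E7 x₀).symm y)) := key _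
  have h4 : ψ.rep x₀ y = ψ.valAt ((chartAt E7 x₀).symm y) ⊙
      (T.symm : E7 →L[ℝ] TangentSpace (𝓡 7) ((chartAt E7 x₀).symm y)) := key _
  rw [h3, h4]
  exact isTamedPair_map_iff T

/-- Around each point, the orientation is constant in the chart on some compact neighbourhood. -/
theorem exists_compact_orientInChart_eq (o : ManifoldOrientation X) (x₀ : X) :
    ∃ (c : Orientation ℝ E7 (Fin 7)) (K : Set E7), IsCompact K ∧ K ⊆ (chartAt E7 x₀).target ∧
      (chartAt E7 x₀).symm '' K ∈ 𝓝 x₀ ∧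
      ∀ y (hy : y ∈ (chartAt E7 x₀).target), y ∈ K →
        orientInChart x₀ ⟨(chartAt E7 x₀).symm y, (chartAt E7 x₀).map_target hy⟩
          (o.orientAt ((chartAt E7 x₀).symm y)) = c := by
  set e := chartAt E7 x₀ with he
  set f : e.source → Orientation ℝ E7 (Fin 7) := fun x => orientInChart x₀ x (o.orientAt x) with hf
  set c := f ⟨x₀, mem_chart_source E7 x₀⟩ with hc
  have hU : IsOpen ((↑) '' {x | f x = c} : Set X) :=
    e.open_source.isOpenMap_subtype_val _ ((o.locallyConstant x₀).isOpen_fiber c)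
  have hsymm : e.symm (e x₀) = x₀ := e.left_inv (mem_chart_source E7 x₀)
  have h1 : ∀ᶠ y in 𝓝 (e x₀), y ∈ e.target ∧ e.symm y ∈ ((↑) '' {x | f x = c} : Set X) := by
    refine Filter.Eventually.and (e.open_target.mem_nhds (mem_chart_target E7 x₀))
      ((e.continuousAt_symm (mem_chart_target E7 x₀)).eventually (hU.mem_nhds ?_))
    exact ⟨⟨x₀, mem_chart_source E7 x₀⟩, rfl, hsymm.symm⟩
  obtain ⟨r, hr, hball⟩ := Metric.nhds_basis_closedBall.mem_iff.1 h1
  refine ⟨c, Metric.closedBall (e x₀) r, isCompact_closedBall _ _, fun y hy => (hball hy).1, ?_, ?_⟩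
  · have h2 := (e.continuousAt (mem_chart_source E7 x₀)).eventually
      (Metric.closedBall_mem_nhds (e x₀) hr)
    filter_upwards [h2, e.open_source.mem_nhds (mem_chart_source E7 x₀)] with x hx hxs
    exact ⟨e x, hx, e.left_inv hxs⟩
  · intro y hy hyK
    obtain ⟨-, ⟨x, hx⟩, hfx, rfl⟩ := hball hyK
    exact hfx

/-- On a compact manifold, tamedness is open in the `C^∞` topology. -/
theorem eventually_isTamedPair [CompactSpace X]
    (h : ∀ x, IsTamedPair (o.orientAt x) (φ.valAt x) (ψ.valAt x)) :
    ∀ᶠ p : DiffForm X 3 × DiffForm X 4 in 𝓝 (φ, ψ),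
      ∀ x, IsTamedPair (o.orientAt x) (p.1.valAt x) (p.2.valAt x) := by
  choose c K hK hKt hKx hc using exists_compact_orientInChart_eq o
  obtain ⟨t, ht⟩ := CompactSpace.elim_nhds_subcover _ hKx
  have hloc : ∀ x₀ : X, ∀ᶠ p : DiffForm X 3 × DiffForm X 4 in 𝓝 (φ, ψ),
      ∀ y ∈ K x₀, IsTamedPair (c x₀) (p.1.rep x₀ y) (p.2.rep x₀ y) := by
    intro x₀
    have hcont : ContinuousOn (fun y => (φ.rep x₀ y, ψ.rep x₀ y)) (K x₀) :=
      ((φ.2 x₀).continuousOn.prodMk (ψ.2 x₀).continuousOn).mono (hKt x₀)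
    obtain ⟨δ, hδ, hsub⟩ := ((hK x₀).image_of_continuousOn hcont).exists_thickening_subset_open
      (isOpen_isTamedPair (c x₀)) (by
        rintro - ⟨y, hy, rfl⟩
        have := (isTamedPair_rep_iff (o := o) x₀ (hKt x₀ hy)).2 (h _)
        rwa [hc x₀ y (hKt x₀ hy) hy] at this)
    rw [nhds_prod_eq]
    filter_upwards [(φ.eventually_dist_rep_lt x₀ (hK x₀) (hKt x₀) hδ).prod_mk
      (ψ.eventually_dist_rep_lt x₀ (hK x₀) (hKt x₀) hδ)] with p hp y hy
    refine hsub (Metric.mem_thickening_iff.2 ⟨_, ⟨y, hy, rfl⟩, ?_⟩)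
      (a := (p.1.rep x₀ y, p.2.rep x₀ y))
    rw [Prod.dist_eq]
    exact max_lt (hp.1 y hy) (hp.2 y hy)
  filter_upwards [(Filter.eventually_all_finset t).2 fun x₀ _ => hloc x₀] with p hp x
  have hx : x ∈ ⋃ x₀ ∈ t, (chartAt E7 x₀).symm '' K x₀ := by
    rw [ht]
    trivial
  simp only [Set.mem_iUnion] at hx
  obtain ⟨x₀, hx₀, y, hy, rfl⟩ := hx
  rw [← isTamedPair_rep_iff x₀ (hKt x₀ hy), hc x₀ y (hKt x₀ hy) hy]
  exact hp x₀ hx₀ y hy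

variable (o φ ψ)

theorem isOpen_coneC [CompactSpace X] : IsOpen (coneC o ψ) := by
  rw [isOpen_iff_mem_nhds]
  intro φ hφ
  have h := (isOrientedTAG2_iff.1 hφ).2
  have hc : Continuous fun η : closedForms X 3 => ((η : DiffForm X 3), ψ) := by fun_prop
  filter_upwards [hc.continuousAt.eventually (eventually_isTamedPair h.2)] with η hη
  exact isOrientedTAG2_iff.2 ⟨η.2, h.1, hη⟩

theorem isConvexCone_coneC : IsConvexCone (coneC o ψ) := by
  refine ⟨⟨coneC o ψ, fun r hr φ hφ => ?_, fun φ hφ φ' hφ' => ?_⟩, rfl⟩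
  · have h := (isOrientedTAG2_iff.1 hφ).2
    exact isOrientedTAG2_iff.2 ⟨(r • φ).2, h.1, fun x => (h.2 x).smul_left hr⟩
  · have h := (isOrientedTAG2_iff.1 hφ).2
    have h' := (isOrientedTAG2_iff.1 hφ').2
    exact isOrientedTAG2_iff.2 ⟨(φ + φ').2, h.1, fun x => (h.2 x).add_left (h'.2 x)⟩

theorem isOpen_coneC' [CompactSpace X] : IsOpen (coneC' φ) := by
  rw [isOpen_iff_mem_nhds]
  rintro ψ ⟨o, hψ⟩
  have h := isOrientedTAG2_iff.1 hψ
  have hc : Continuous fun η : closedForms X 4 => (φ, (η : DiffForm X 4)) := by fun_prop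
  filter_upwards [hc.continuousAt.eventually (eventually_isTamedPair h.2.2)] with η hη
  exact ⟨o, isOrientedTAG2_iff.2 ⟨h.1, η.2, hη⟩⟩

variable {φ}

/-- A positive 3-form induces at most one orientation. -/
theorem IsInducedBy.orientAt_eq {o o' : ManifoldOrientation X} (hφ : IsPositive3 φ)
    (h : IsInducedBy o φ) (h' : IsInducedBy o' φ) (x : X) : o.orientAt x = o'.orientAt x := by
  obtain ⟨L, hL⟩ := hφ x
  exact (Orientation.map (Fin 7) L.toLinearEquiv).injective ((h x L hL).trans (h' x L hL).symm)

variable (φ)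

theorem isConvexCone_coneC' : IsConvexCone (coneC' φ) := by
  refine ⟨⟨coneC' φ, ?_, ?_⟩, rfl⟩
  · rintro r hr ψ ⟨o, hψ⟩
    have h := isOrientedTAG2_iff.1 hψ
    exact ⟨o, isOrientedTAG2_iff.2 ⟨h.1, (r • ψ).2, fun x => (h.2.2 x).smul_right hr⟩⟩
  · rintro ψ ⟨o, hψ⟩ ψ' ⟨o', hψ'⟩
    have h := isOrientedTAG2_iff.1 hψ
    have h' := isOrientedTAG2_iff.1 hψ'
    refine ⟨o, isOrientedTAG2_iff.2 ⟨h.1, (ψ + ψ').2, fun x => (h.2.2 x).add_right ?_⟩⟩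
    rw [hψ.induced.orientAt_eq hψ.positive_phi hψ'.induced x]
    exact h'.2.2 x

end

end TAG2

end

theorem proposition2p2 (X : Type*) [TopologicalSpace X] [T2Space X] [CompactSpace X]
    [ChartedSpace TAG2.E7 X] [IsManifold (𝓡 7) ∞ X] :
    (∀ (o : TAG2.ManifoldOrientation X) (ψ : TAG2.DiffForm X 4),
      ψ ∈ TAG2.closedForms X 4 → TAG2.IsPositive4 ψ →
        (IsOpen (TAG2.coneC o ψ) ∧ TAG2.IsConvexCone (TAG2.coneC o ψ)) ∧
        (IsOpen (TAG2.deRhamClass '' TAG2.coneC o ψ) ∧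
          IsOpen[moduleTopology ℝ (TAG2.HdR X 3)] (TAG2.deRhamClass '' TAG2.coneC o ψ) ∧
          TAG2.IsConvexCone (TAG2.deRhamClass '' TAG2.coneC o ψ))) ∧
    (∀ φ : TAG2.DiffForm X 3,
      φ ∈ TAG2.closedForms X 3 → TAG2.IsPositive3 φ →
        (IsOpen (TAG2.coneC' φ) ∧ TAG2.IsConvexCone (TAG2.coneC' φ)) ∧
        (IsOpen (TAG2.deRhamClass '' TAG2.coneC' φ) ∧
          IsOpen[moduleTopology ℝ (TAG2.HdR X 4)] (TAG2.deRhamClass '' TAG2.coneC' φ) ∧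
          TAG2.IsConvexCone (TAG2.deRhamClass '' TAG2.coneC' φ))) :=
  ⟨fun o ψ _ _ => ⟨⟨TAG2.isOpen_coneC o ψ, TAG2.isConvexCone_coneC o ψ⟩,
    TAG2.image_mk_of_isOpen_of_isConvexCone _ (TAG2.isOpen_coneC o ψ)
      (TAG2.isConvexCone_coneC o ψ)⟩,
  fun φ _ _ => ⟨⟨TAG2.isOpen_coneC' φ, TAG2.isConvexCone_coneC' φ⟩,
    TAG2.image_mk_of_isOpen_of_isConvexCone _ (TAG2.isOpen_coneC' φ)
      (TAG2.isConvexCone_coneC' φ)⟩⟩
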